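/- Let $\phi,\psi:[0,1]\to\mathbf{R}$ be quadratic (polynomials of degree at most two) such that $\phi$ is concave with $\phi(0)=\phi(1)=0$, $-1<\phi'(1)<0$, and $\psi$ is convex with $\psi(1)=0$, $\psi'(1)<0$, $\psi''(1)-\phi''(1)>0$. Let $w(x,t)$, $0\le x<1$, $t\ge 0$, together with a continuous function $\kappa:[0,\infty)\to\mathbf{R}$, be a solution of $$\frac{\partial w}{\partial t}(x,t)+[\phi(x)-\kappa(t)\psi(x)]\frac{\partial w}{\partial x}(x,t)=w(x,t),\qquad \int_0^1 w(x,t)\,dx=1,\qquad 0\le x<1,\ t\ge 0,$$ with initial data of the form $w(x,0)=\int_x^1c_0(x')\,dx'>0$, $0\le x<1$, where $c_0\ge 0$ is integrable on $[0,1]$. Here the equation is understood along characteristics: through each point $(x,T)$, $0\le x<1$, $T\ge0$, there is a curve $x(s)\in[0,1)$, $0\le s\le T$, with $x'(s)=\phi(x(s))-\kappa(s)\psi(x(s))$, $x(T)=x$, along which $\frac{d}{ds}w(x(s),s)=w(x(s),s)$; equivalently $w(x,T)=e^Tw(x(0),0)$. The beta function of $w(\cdot,t)$ is $$\beta(x,t)=\frac{c(x,t)h(x,t)}{w(x,t)^2},\qquad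 c(x,t)=-\frac{\partial w}{\partial x}(x,t),\qquad h(x,t)=\int_x^1w(x',t)\,dx',$$ defined at those $x\in[0,1)$ at which the derivative $\partial w(x,t)/\partial x$ exists (almost every $x$, and every $x$ if $c_0$ is continuous on $[0,1)$). Put $\kappa_0=\phi'(1)/\psi'(1)$, and let $\beta_{\kappa_0}$ be the beta function of the time independent solution $$w_{\kappa_0}(x)=C\exp\Big[-\int_0^x\frac{dz}{\kappa_0\psi(z)-\phi(z)}\Big],\qquad 0\le x<1,\qquad \int_0^1w_{\kappa_0}(x)\,dx=1 .$$ Suppose that the initial data is critical, that is $\lim_{x\to1}\beta(x,0)=1$, and that there exists $\delta>0$ such that $\beta(x,0)\le 1$ for $1-\delta\le x<1$ (both over the $x$ at which $\beta(x,0)$ is defined). Then $$\lim_{t\to\infty}\|\beta(\cdot,t)-\beta_{\kappa_0}(\cdot)\|_\infty=0,$$ where $\|\cdot\|_\infty$ is the supremum over all $x\in[0,1)$ at which $\beta(x,t)$ is defined. -/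

import Mathlib

open Set Filter Topology MeasureTheory

namespace LSW

/-- The standing assumptions on the coefficients `φ`, `ψ` on `[0,1]`, for quadratic coefficients.
A quadratic function on `[0,1]` is identified with the polynomial function on `ℝ` that extends it
(degree at most two), so that the derivatives at the end point `1` are ordinary derivatives. -/
structure IsQuadraticModel (φ ψ : ℝ → ℝ) : Prop where
  quadratic_φ : ∃ a b c : ℝ, ∀ x, φ x = a * x ^ 2 + b * x + c
  quadratic_ψ : ∃ a b c : ℝ, ∀ x, ψ x = a * x ^ 2 + b * x + c
  concave_φ : ConcaveOn ℝ (Icc 0 1) φ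
  φ_zero : φ 0 = 0
  φ_one : φ 1 = 0
  deriv_φ_gt : -1 < deriv φ 1
  deriv_φ_neg : deriv φ 1 < 0
  convex_ψ : ConvexOn ℝ (Icc 0 1) ψ
  ψ_one : ψ 1 = 0
  deriv_ψ_neg : deriv ψ 1 < 0
  second_deriv : 0 < deriv (deriv ψ) 1 - deriv (deriv φ) 1

/-- `c(x) = -f'(x)` for a function `f` on `[0,1)` (one-sided derivative at `0`). -/
noncomputable def density (f : ℝ → ℝ) (x : ℝ) : ℝ := -derivWithin f (Ico 0 1) x

/-- `h(x) = ∫ₓ¹ f`. -/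
noncomputable def tail (f : ℝ → ℝ) (x : ℝ) : ℝ := ∫ z in x..1, f z

/-- The beta function `c h / w²` of a function `w` on `[0,1)`. -/
noncomputable def beta (w : ℝ → ℝ) (x : ℝ) : ℝ := density w x * tail w x / w x ^ 2

/-- The points of `[0,1)` at which the derivative of `w`, and hence its beta function, is defined.
For `w x = ∫ₓ¹ c` with `c` integrable these are almost all points of `[0,1)`, and all of them when
`c` is continuous. -/
def betaDomain (w : ℝ → ℝ) : Set ℝ := {x ∈ Ico 0 1 | DifferentiableWithinAt ℝ w (Ico 0 1) x}

/-- Initial data with a density: `w₀ x = ∫ₓ¹ c₀` with `c₀ ≥ 0` integrable, and `w₀ > 0` on `[0,1)`.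
Such `w₀` is continuous, decreasing, and tends to `0` at `1`. -/
structure IsInitialDatum (w₀ : ℝ → ℝ) : Prop where
  exists_density : ∃ c₀ : ℝ → ℝ, (∀ x ∈ Ico (0 : ℝ) 1, 0 ≤ c₀ x) ∧
    IntervalIntegrable c₀ volume 0 1 ∧ ∀ x ∈ Ico (0 : ℝ) 1, w₀ x = ∫ z in x..1, c₀ z
  pos : ∀ x ∈ Ico (0 : ℝ) 1, 0 < w₀ x

/-- `y` is a characteristic of `∂ₜ + [φ - κ ψ] ∂ₓ` on the time interval `[0,T]`, inside `[0,1)`. -/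
def IsCharacteristic (φ ψ κ : ℝ → ℝ) (T : ℝ) (y : ℝ → ℝ) : Prop :=
  ∀ s ∈ Icc 0 T, y s ∈ Ico (0 : ℝ) 1 ∧
    HasDerivWithinAt y (φ (y s) - κ s * ψ (y s)) (Icc 0 T) s

/-- `(w, κ)` solves `∂ₜ w + [φ - κ ψ] ∂ₓ w = w` on `0 ≤ x < 1`, `t ≥ 0`, with the conservation law
`∫₀¹ w(x,t) dx = 1`. The left side of the equation is read as the derivative of `w` along the
characteristics, because `w(·,t)` need not be differentiable everywhere. Through every point
`(x,T)` there passes a characteristic that stays in `[0,1)` on `[0,T]`: this is automatic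
for `κ ≥ 0`, and says that `x = 0` is not an inflow boundary. -/
structure IsSolution (φ ψ : ℝ → ℝ) (w : ℝ → ℝ → ℝ) (κ : ℝ → ℝ) : Prop where
  continuous_κ : ContinuousOn κ (Ici 0)
  transport : ∀ T, 0 ≤ T → ∀ x ∈ Ico (0 : ℝ) 1, ∃ y, IsCharacteristic φ ψ κ T y ∧ y T = x ∧
    ∀ s ∈ Icc 0 T, HasDerivWithinAt (fun r => w (y r) r) (w (y s) s) (Icc 0 T) s
  mass : ∀ t, 0 ≤ t → ∫ x in (0 : ℝ)..1, w x t = 1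

/-- `κ₀ = φ'(1) / ψ'(1)`. -/
noncomputable def kappaZero (φ ψ : ℝ → ℝ) : ℝ := deriv φ 1 / deriv ψ 1

/-- `exp (-∫₀ˣ dz / (κ ψ z - φ z))`, the time independent solution before normalization. -/
noncomputable def stationaryExp (φ ψ : ℝ → ℝ) (κ x : ℝ) : ℝ :=
  Real.exp (-∫ z in (0 : ℝ)..x, 1 / (κ * ψ z - φ z))

/-- The time independent solution `w_κ` with `∫₀¹ w_κ = 1`: on `[0,1)` it is the positive solution
of `[φ - κ ψ] w' = w`. -/
noncomputable def stationary (φ ψ : ℝ → ℝ) (κ x : ℝ) : ℝ :=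
  stationaryExp φ ψ κ x / ∫ z in (0 : ℝ)..1, stationaryExp φ ψ κ z

theorem critical_coefficient {φ ψ : ℝ → ℝ} (hm : IsQuadraticModel φ ψ) :
    ∃ A : ℝ, 0 < A ∧ ∀ x, kappaZero φ ψ * ψ x - φ x = A * (1 - x) ^ 2 := by
  obtain ⟨a, b, c, hφ⟩ := hm.quadratic_φ
  obtain ⟨p, q, r, hψ⟩ := hm.quadratic_ψ
  have hd : ∀ (f : ℝ → ℝ) (a b c : ℝ), (∀ x, f x = a * x ^ 2 + b * x + c) →
      deriv f 1 = 2 * a + b := by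
    intro f a b c hf
    have h1 : HasDerivAt (fun x : ℝ => a * x ^ 2 + b * x + c) (2 * a + b) 1 := by
      have := (((hasDerivAt_pow 2 (1 : ℝ)).const_mul a).add
        ((hasDerivAt_id (1 : ℝ)).const_mul b)).add_const c
      have he : a * (((2 : ℕ) : ℝ) * 1 ^ (2 - 1)) + b * 1 = 2 * a + b := by norm_num [mul_comm]
      exact he ▸ this
    rw [funext hf]; exact h1.deriv
  have dφ := hd φ a b c hφ
  have dψ := hd ψ p q r hψ
  have h0 := hm.φ_zero
  have h1 := hm.φ_one
  have h2 := hm.ψ_one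
  have h3 := hm.deriv_φ_neg
  have h4 := hm.deriv_ψ_neg
  rw [hφ] at h0 h1
  rw [hψ] at h2
  have hc : c = 0 := by linarith
  have hb : b = -a := by linarith
  have hp : 0 ≤ p := by
    have := hm.convex_ψ.2 (left_mem_Icc.2 (zero_le_one' ℝ)) (right_mem_Icc.2 (zero_le_one' ℝ))
      (by norm_num : (0 : ℝ) ≤ 1 / 2) (by norm_num : (0 : ℝ) ≤ 1 / 2) (by norm_num)
    simp only [hψ, smul_eq_mul] at this
    linarith
  have hk : kappaZero φ ψ * (2 * p + q) = a := by
    unfold kappaZero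
    rw [dφ, dψ, hb]
    rw [dψ] at h4
    field_simp [h4.ne]
    ring
  have ha : a < 0 := by rw [dφ] at h3; linarith
  have hkpos : 0 ≤ kappaZero φ ψ := div_nonneg_of_nonpos h3.le h4.le
  refine ⟨kappaZero φ ψ * p - a, by nlinarith [mul_nonneg hkpos hp], fun x => ?_⟩
  rw [hφ, hψ, hc, hb, show r = -p - q by linarith]
  linear_combination (x - 1) * hk

theorem stationaryExp_hasDerivAt {φ ψ : ℝ → ℝ} {κ A : ℝ} (hA : 0 < A)
    (h : ∀ x, κ * ψ x - φ x = A * (1 - x) ^ 2) {x : ℝ} (hx : x ∈ Ico (0 : ℝ) 1) :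
    HasDerivAt (stationaryExp φ ψ κ)
      (stationaryExp φ ψ κ x * -(1 / (A * (1 - x) ^ 2))) x := by
  have hne : ∀ z : ℝ, z < 1 → A * (1 - z) ^ 2 ≠ 0 := fun z hz => by
    have : 0 < 1 - z := by linarith
    positivity
  have hcont : ContinuousOn (fun z : ℝ => 1 / (A * (1 - z) ^ 2)) (Iio 1) :=
    ContinuousOn.div (by fun_prop) (by fun_prop) (fun z hz => hne z hz)
  have hint : HasDerivAt (fun x => ∫ z in (0 : ℝ)..x, 1 / (A * (1 - z) ^ 2))
      (1 / (A * (1 - x) ^ 2)) x := by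
    refine intervalIntegral.integral_hasDerivAt_right ?_ ?_ ?_
    · refine (hcont.mono fun z hz => ?_).intervalIntegrable
      rw [uIcc_of_le hx.1] at hz
      exact lt_of_le_of_lt hz.2 hx.2
    · exact hcont.stronglyMeasurableAtFilter isOpen_Iio x hx.2
    · exact hcont.continuousAt (isOpen_Iio.mem_nhds hx.2)
  unfold stationaryExp
  simp only [h]
  exact hint.neg.exp

/-- The normalizing integral is positive. -/
theorem stationaryExp_mass_pos {φ ψ : ℝ → ℝ} (hm : IsQuadraticModel φ ψ) :
    0 < ∫ z in (0 : ℝ)..1, stationaryExp φ ψ (kappaZero φ ψ) z := by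
  obtain ⟨A, hA, h⟩ := critical_coefficient hm
  refine intervalIntegral.intervalIntegral_pos_of_pos_on ?_ (fun x _ => Real.exp_pos _)
    (one_pos (α := ℝ))
  rw [intervalIntegrable_iff_integrableOn_Ioo_of_le zero_le_one]
  refine Integrable.of_bound (μ := volume.restrict (Ioo 0 1)) ?_ 1 ?_
  · have hc : ContinuousOn (stationaryExp φ ψ (kappaZero φ ψ)) (Ioo 0 1) := fun x hx =>
      (stationaryExp_hasDerivAt hA h ⟨le_of_lt hx.1, hx.2⟩).continuousAt.continuousWithinAt
    exact hc.aestronglyMeasurable measurableSet_Ioo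
  · refine (ae_restrict_mem measurableSet_Ioo).mono fun x hx => ?_
    rw [Real.norm_eq_abs, stationaryExp, Real.abs_exp, Real.exp_le_one_iff, neg_nonpos]
    refine intervalIntegral.integral_nonneg (μ := volume) (le_of_lt hx.1) fun z _ => ?_
    rw [h]
    positivity

/-- `w_{κ₀}` is a time independent solution for `κ = κ₀`. -/
theorem stationary_spec {φ ψ : ℝ → ℝ} (hm : IsQuadraticModel φ ψ) :
    (∀ x, 0 < stationary φ ψ (kappaZero φ ψ) x) ∧
    (∫ x in (0 : ℝ)..1, stationary φ ψ (kappaZero φ ψ) x) = 1 ∧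
    ∀ x ∈ Ico (0 : ℝ) 1, ∃ d, HasDerivAt (stationary φ ψ (kappaZero φ ψ)) d x ∧
      (φ x - kappaZero φ ψ * ψ x) * d = stationary φ ψ (kappaZero φ ψ) x := by
  have hN := stationaryExp_mass_pos hm
  obtain ⟨A, hA, h⟩ := critical_coefficient hm
  refine ⟨fun x => div_pos (Real.exp_pos _) hN, ?_, fun x hx => ?_⟩
  · unfold stationary
    rw [intervalIntegral.integral_div, div_self hN.ne']
  · refine ⟨_, (stationaryExp_hasDerivAt hA h hx).div_const _, ?_⟩
    have h1 : 0 < 1 - x := by linarith [hx.2]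
    rw [show φ x - kappaZero φ ψ * ψ x = -(A * (1 - x) ^ 2) by rw [← h]; ring]
    unfold stationary
    field_simp

end LSW

/-!
Write `b = -φ'(1)`, `m = -ψ'(1)` and `p = ψ''/2`, so that `φ x = b x (1 - x)` and
`ψ x = (1 - x) (m + p (1 - x))` with `0 < b < 1`, `0 < m`, `0 ≤ p`. In the coordinate
`u = 1 / (1 - x) ∈ [1, ∞)` the characteristics solve a linear equation, so the solution is
`w(x,T) = exp T * W (α u + γ)`, where `W` is the initial datum in this coordinate
(`profile`), `α = dilation T` and `γ = shift T` (`IsSolution.eq_exp_mul_profile`). The point `x = 0`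
corresponds to `v₁ = α + γ = front T`, and `v₁' = (m + p) κ α`, `α' = (m κ - b) α` with `κ ≥ 0`.

*Critical data are locally exponential.* Let `h` be the tail integral of the datum and
`ρ = v² h / W` (`scale`), so that `ℓ = -log h` (`potential`) is a primitive of `1 / ρ`. As `β → 1`,
an integral Gronwall inequality shows that `-log W` and `ℓ` have nearly the same increments near
infinity. It follows that `ρ` has a Lipschitz constant tending to `0`
(`IsInitialDatum.eventually_slowly_varying`), and that `X_v(s) = W(v + ρ s) / W(v)` converges to
`exp (-s)` in `L¹(0, ∞)` as `v → ∞`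
(`IsInitialDatum.tendsto_integral_abs_rescaled_sub_exp`).

*Reduction to one number.* With `B(v,q) = ∫₀^∞ X_v(s) / (1 + q s)² ds` (`weighted`), a change of
variables gives `β(x,T) ≈ B(v, ρ(v) / (α u))` for `v = α u + γ`, whereas the stationary beta
function is `∫₀^∞ exp (-s) / (1 + A s / u)² ds` with `A = b (m + p) / m`
(`beta_stationary`). Since `ρ` is almost constant, the theorem follows from `v₁ → ∞` and
`q := ρ(v₁) / α → A` (`IsCriticalFlow.tendsto_frontScale`).

*Dynamics of `q`.* Put `G = -(1 + 1/b) log q - log B(v₁, q)` (`frontEnergy`). By conservation of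
mass, `G = T + log W(v₁) - (1/b) log q`, whose increments are those of
`(m + p) ∫ (1/A - 1/q) κ dT`, up to a small multiple of `(m + p) ∫ κ / q dT`. On the other hand
`q² B(v,q)` increases with `q`, and `1 + 1/b > 2`, so `G` is a strictly decreasing function of `q`
up to a vanishing error. Thus `G` grows while `q > A`, which forces `q` down, and drops while
`q < A`, which forces `q` up; as `∫₀^∞ κ = ∞`, a barrier argument (`eventually_lt_of_barrier`) gives
`q → A`.
-/

namespace LSW

/-! ### Monotonicity from derivatives -/

theorem le_of_hasDerivAt_nonneg {f f' : ℝ → ℝ} {a b : ℝ} (hab : a ≤ b)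
    (hf : ∀ x ∈ Icc a b, HasDerivAt f (f' x) x) (hf' : ∀ x ∈ Icc a b, 0 ≤ f' x) : f a ≤ f b :=
  monotoneOn_of_hasDerivWithinAt_nonneg (convex_Icc a b)
    (fun x hx => (hf x hx).continuousAt.continuousWithinAt)
    (fun x hx => (hf x (interior_subset hx)).hasDerivWithinAt)
    (fun x hx => hf' x (interior_subset hx)) (left_mem_Icc.2 hab) (right_mem_Icc.2 hab) hab

theorem le_of_hasDerivAt_nonpos {f f' : ℝ → ℝ} {a b : ℝ} (hab : a ≤ b)
    (hf : ∀ x ∈ Icc a b, HasDerivAt f (f' x) x) (hf' : ∀ x ∈ Icc a b, f' x ≤ 0) : f b ≤ f a :=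
  neg_le_neg_iff.1 <| le_of_hasDerivAt_nonneg (f := fun x => -f x) (f' := fun x => -f' x) hab
    (fun x hx => (hf x hx).neg) (fun x hx => neg_nonneg.2 (hf' x hx))

/-- If `log k` varies by at most `ε` times the variation of a primitive `l` of `1 / k`, then `k` is
`ε`-Lipschitz: formally `|k'| = k |(log k)'| ≤ ε`. No differentiability of `k` is needed, because
`k` is compared with the differentiable functions `k x * exp (-ε (l - l x))` and
`k y * exp (-ε (l y - l))`, which lie below it. -/
theorem abs_sub_le_of_abs_log_sub_le {k l : ℝ → ℝ} {x y ε : ℝ} (hε : 0 ≤ ε) (hxy : x ≤ y)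
    (hk : ∀ z ∈ Icc x y, 0 < k z) (hl : ∀ z ∈ Icc x y, HasDerivAt l (1 / k z) z)
    (hlog : ∀ a b, x ≤ a → a ≤ b → b ≤ y → |Real.log (k b) - Real.log (k a)| ≤ ε * (l b - l a)) :
    |k y - k x| ≤ ε * (y - x) := by
  have hx := left_mem_Icc.2 hxy
  have hy := right_mem_Icc.2 hxy
  have key : ∀ u v c, 0 < u → 0 < v → Real.log u - Real.log v ≤ c → u * Real.exp (-c) ≤ v := by
    intro u v c hu hv h
    rw [← Real.log_le_log_iff (by positivity) hv, Real.log_mul hu.ne' (Real.exp_pos _).ne',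
      Real.log_exp]
    linarith
  have h1 : ∀ z ∈ Icc x y, k x * Real.exp (-(ε * (l z - l x))) ≤ k z := fun z hz =>
    key _ _ _ (hk x hx) (hk z hz) (by
      have := abs_le.1 (hlog x z le_rfl hz.1 hz.2); linarith)
  have h2 : ∀ z ∈ Icc x y, k y * Real.exp (-(ε * (l y - l z))) ≤ k z := fun z hz =>
    key _ _ _ (hk y hy) (hk z hz) (by
      have := abs_le.1 (hlog z y hz.1 hz.2 le_rfl); linarith)
  have hd : ∀ z ∈ Icc x y, ∀ E, 0 ≤ E → E ≤ k z → E * (ε * (1 / k z)) ≤ ε := by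
    intro z hz E _ hE
    have hkz := hk z hz
    rw [show E * (ε * (1 / k z)) = ε * (E / k z) by ring]
    exact mul_le_of_le_one_right hε ((div_le_one hkz).2 hE)
  have e1 := le_of_hasDerivAt_nonneg
    (f := fun z => k x * Real.exp (-(ε * (l z - l x))) + ε * z)
    (f' := fun z => k x * (Real.exp (-(ε * (l z - l x))) * (-(ε * (1 / k z)))) + ε * 1) hxy
    (fun z hz => (((((hl z hz).sub_const _).const_mul ε).neg.exp).const_mul _).add
      ((hasDerivAt_id z).const_mul ε))
    (fun z hz => by
      have := hd z hz _ (by have := hk x hx; positivity) (h1 z hz)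
      linarith)
  have e2 := le_of_hasDerivAt_nonneg
    (f := fun z => -(k y * Real.exp (-(ε * (l y - l z)))) + ε * z)
    (f' := fun z => -(k y * (Real.exp (-(ε * (l y - l z))) * (-(ε * (-(1 / k z)))))) + ε * 1) hxy
    (fun z hz => ((((((hl z hz).const_sub _).const_mul ε).neg.exp).const_mul _).neg).add
      ((hasDerivAt_id z).const_mul ε))
    (fun z hz => by
      have := hd z hz _ (by have := hk y hy; positivity) (h2 z hz)
      linarith)
  have a1 := h1 y hy
  have a2 := h2 x hx
  simp only [sub_self, mul_zero, neg_zero, Real.exp_zero, mul_one] at e1 e2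
  rw [abs_le]
  constructor <;> linarith

/-! ### Initial data -/

namespace IsInitialDatum

variable {f : ℝ → ℝ}

theorem exists_density_sub (hf : IsInitialDatum f) : ∃ c : ℝ → ℝ,
    (∀ x ∈ Ico (0 : ℝ) 1, 0 ≤ c x) ∧ IntervalIntegrable c volume 0 1 ∧
    ∀ x ∈ Ico (0 : ℝ) 1, ∀ y ∈ Ico (0 : ℝ) 1, f x - f y = ∫ z in x..y, c z := by
  obtain ⟨c, h0, hi, hc⟩ := hf.exists_density
  have hI : ∀ x ∈ Ico (0 : ℝ) 1, ∀ y ∈ Icc (0 : ℝ) 1, IntervalIntegrable c volume x y := by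
    intro x hx y hy
    refine hi.mono_set ?_
    rw [uIcc_of_le (zero_le_one' ℝ)]
    exact uIcc_subset_Icc ⟨hx.1, hx.2.le⟩ hy
  refine ⟨c, h0, hi, fun x hx y hy => ?_⟩
  rw [hc x hx, hc y hy, ← intervalIntegral.integral_add_adjacent_intervals
    (hI x hx y ⟨hy.1, hy.2.le⟩) (hI y hy 1 ⟨zero_le_one, le_rfl⟩)]
  ring

theorem continuousOn (hf : IsInitialDatum f) : ContinuousOn f (Ico 0 1) := by
  obtain ⟨c, -, hi, hs⟩ := hf.exists_density_sub
  have h1 := intervalIntegral.continuousOn_primitive_interval' hi left_mem_uIcc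
  rw [uIcc_of_le (zero_le_one' ℝ)] at h1
  have h2 : ContinuousOn (fun x => f 0 - ∫ z in (0 : ℝ)..x, c z) (Ico 0 1) :=
    continuousOn_const.sub (h1.mono Ico_subset_Icc_self)
  refine h2.congr fun x hx => ?_
  have := hs 0 ⟨le_rfl, one_pos⟩ x hx
  simp only
  linarith

theorem antitoneOn (hf : IsInitialDatum f) : AntitoneOn f (Ico 0 1) := by
  obtain ⟨c, h0, -, hs⟩ := hf.exists_density_sub
  intro x hx y hy hxy
  have : 0 ≤ ∫ z in x..y, c z := intervalIntegral.integral_nonneg hxy fun z hz =>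
    h0 z ⟨hx.1.trans hz.1, hz.2.trans_lt hy.2⟩
  have := hs x hx y hy
  linarith

theorem intervalIntegrable (hf : IsInitialDatum f) {x y : ℝ} (hx : x ∈ Icc (0 : ℝ) 1)
    (hy : y ∈ Icc (0 : ℝ) 1) : IntervalIntegrable f volume x y := by
  have : IntervalIntegrable f volume 0 1 := by
    rw [intervalIntegrable_iff_integrableOn_Ioo_of_le zero_le_one]
    refine Integrable.of_bound (μ := volume.restrict (Ioo 0 1)) ?_ (f 0) ?_
    · exact (hf.continuousOn.mono Ioo_subset_Ico_self).aestronglyMeasurable measurableSet_Ioo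
    · refine (ae_restrict_mem measurableSet_Ioo).mono fun x hx => ?_
      rw [Real.norm_eq_abs, abs_of_pos (hf.pos x ⟨hx.1.le, hx.2⟩)]
      exact hf.antitoneOn ⟨le_rfl, one_pos⟩ ⟨hx.1.le, hx.2⟩ hx.1.le
  refine this.mono_set ?_
  rw [uIcc_of_le (zero_le_one' ℝ)]
  exact uIcc_subset_Icc hx hy

theorem tail_hasDerivAt (hf : IsInitialDatum f) {x : ℝ} (hx : x ∈ Ioo (0 : ℝ) 1) :
    HasDerivAt (tail f) (-f x) x := by
  refine intervalIntegral.integral_hasDerivAt_left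
    (hf.intervalIntegrable ⟨hx.1.le, hx.2.le⟩ ⟨zero_le_one, le_rfl⟩) ?_ ?_
  · exact (hf.continuousOn.mono Ioo_subset_Ico_self).stronglyMeasurableAtFilter isOpen_Ioo x hx
  · exact hf.continuousOn.continuousAt (Ico_mem_nhds hx.1 hx.2)

theorem tail_pos (hf : IsInitialDatum f) {x : ℝ} (hx : x ∈ Ico (0 : ℝ) 1) : 0 < tail f x :=
  intervalIntegral.intervalIntegral_pos_of_pos_on
    (hf.intervalIntegrable ⟨hx.1, hx.2.le⟩ ⟨zero_le_one, le_rfl⟩)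
    (fun _ hz => hf.pos _ ⟨hx.1.trans hz.1.le, hz.2⟩) hx.2

theorem tail_le (hf : IsInitialDatum f) {x : ℝ} (hx : x ∈ Ico (0 : ℝ) 1) :
    tail f x ≤ (1 - x) * f x := by
  have h := intervalIntegral.integral_mono_on_of_le_Ioo (μ := volume) hx.2.le
    (hf.intervalIntegrable ⟨hx.1, hx.2.le⟩ ⟨zero_le_one, le_rfl⟩)
    (intervalIntegrable_const (c := f x))
    (fun _ hz => hf.antitoneOn hx ⟨hx.1.trans hz.1.le, hz.2⟩ hz.1.le)
  rwa [intervalIntegral.integral_const, smul_eq_mul] at h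

/-- Almost everywhere, the density of an initial datum is `β f² / h`. -/
theorem exists_density_ae (hf : IsInitialDatum f) : ∃ c : ℝ → ℝ,
    IntervalIntegrable c volume 0 1 ∧
    (∀ x ∈ Ico (0 : ℝ) 1, ∀ y ∈ Ico (0 : ℝ) 1, f x - f y = ∫ z in x..y, c z) ∧
    ∀ᵐ x, x ∈ Ioo (0 : ℝ) 1 → x ∈ betaDomain f ∧ c x = beta f x * (f x ^ 2 / tail f x) := by
  obtain ⟨c, -, hi, hs⟩ := hf.exists_density_sub
  refine ⟨c, hi, hs, ?_⟩
  filter_upwards [hi.ae_hasDerivAt_integral] with x hx hx'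
  have hxI : x ∈ Ico (0 : ℝ) 1 := ⟨hx'.1.le, hx'.2⟩
  have h1 := hx (by rw [uIcc_of_le (zero_le_one' ℝ)]; exact ⟨hx'.1.le, hx'.2.le⟩) 0 left_mem_uIcc
  have h2 : HasDerivWithinAt f (-c x) (Ico 0 1) x := by
    refine ((h1.const_sub (f 0)).hasDerivWithinAt).congr (fun y hy => ?_) ?_
    · rw [← hs 0 ⟨le_rfl, one_pos⟩ y hy]; ring
    · rw [← hs 0 ⟨le_rfl, one_pos⟩ x hxI]; ring
  refine ⟨⟨hxI, h2.differentiableWithinAt⟩, ?_⟩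
  have h3 : density f x = c x := by
    rw [density, h2.derivWithin (uniqueDiffOn_Ico 0 1 x hxI), neg_neg]
  have := hf.pos x hxI
  have := hf.tail_pos hxI
  rw [beta, h3]
  field_simp

theorem continuousOn_sq_div_tail (hf : IsInitialDatum f) :
    ContinuousOn (fun z => f z ^ 2 / tail f z) (Ioo 0 1) :=
  ((hf.continuousOn.mono Ioo_subset_Ico_self).pow 2).div
    (fun _ hz => (hf.tail_hasDerivAt hz).continuousAt.continuousWithinAt)
    (fun _ hz => (hf.tail_pos ⟨hz.1.le, hz.2⟩).ne')

/-- The comparison function of the Gronwall argument. -/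
theorem hasDerivAt_comparison (hf : IsInitialDatum f) {x y z lam : ℝ} (hx : 0 < x)
    (hy : y < 1) (hz : z ∈ Icc x y) :
    HasDerivAt (fun z => f y + lam * ∫ u in z..y, f u ^ 2 / tail f u)
      (-(lam * (f z ^ 2 / tail f z))) z := by
  have hzI : z ∈ Ioo (0 : ℝ) 1 := ⟨hx.trans_le hz.1, hz.2.trans_lt hy⟩
  have hcont := hf.continuousOn_sq_div_tail
  have : HasDerivAt (fun z => ∫ u in z..y, f u ^ 2 / tail f u) (-(f z ^ 2 / tail f z)) z := by
    refine intervalIntegral.integral_hasDerivAt_left ?_ ?_ ?_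
    · refine (hcont.mono ?_).intervalIntegrable
      rw [uIcc_of_le hz.2]
      exact fun u hu => ⟨hzI.1.trans_le hu.1, hu.2.trans_lt hy⟩
    · exact hcont.stronglyMeasurableAtFilter isOpen_Ioo z hzI
    · exact hcont.continuousAt (isOpen_Ioo.mem_nhds hzI)
  exact ((this.const_mul lam).const_add (f y)).congr_deriv (by ring)

/-- Integral Gronwall inequality: if `f' ≥ -λ f² / h` in integrated form, then
`(log f)' ≥ λ (log h)'` in integrated form. -/
theorem log_sub_log_le (hf : IsInitialDatum f) {x y lam : ℝ} (hlam : 0 ≤ lam) (hx : 0 < x)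
    (hxy : x ≤ y) (hy : y < 1)
    (h : ∀ z ∈ Icc x y, f z - f y ≤ lam * ∫ u in z..y, f u ^ 2 / tail f u) :
    Real.log (f x) - Real.log (f y) ≤ lam * (Real.log (tail f x) - Real.log (tail f y)) := by
  set P : ℝ → ℝ := fun z => f y + lam * ∫ u in z..y, f u ^ 2 / tail f u with hP
  have hI : ∀ z ∈ Icc x y, z ∈ Ioo (0 : ℝ) 1 := fun z hz =>
    ⟨hx.trans_le hz.1, hz.2.trans_lt hy⟩
  have hfpos : ∀ z ∈ Icc x y, 0 < f z := fun z hz => hf.pos z ⟨(hI z hz).1.le, (hI z hz).2⟩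
  have htpos : ∀ z ∈ Icc x y, 0 < tail f z := fun z hz =>
    hf.tail_pos ⟨(hI z hz).1.le, (hI z hz).2⟩
  have hPf : ∀ z ∈ Icc x y, f z ≤ P z := fun z hz => by have := h z hz; simp only [hP]; linarith
  have hPpos : ∀ z ∈ Icc x y, 0 < P z := fun z hz => (hfpos z hz).trans_le (hPf z hz)
  have key := le_of_hasDerivAt_nonneg
    (f := fun z => Real.log (P z) - lam * Real.log (tail f z))
    (f' := fun z => -(lam * (f z ^ 2 / tail f z)) / P z - lam * (-f z / tail f z)) hxy
    (fun z hz => ((hf.hasDerivAt_comparison hx hy hz).log (hPpos z hz).ne').sub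
      (((hf.tail_hasDerivAt (hI z hz)).log (htpos z hz).ne').const_mul lam))
    (fun z hz => by
      have h1 := hfpos z hz
      have h2 := htpos z hz
      have h3 := hPpos z hz
      have : -(lam * (f z ^ 2 / tail f z)) / P z - lam * (-f z / tail f z)
          = lam * (f z / tail f z) * ((P z - f z) / P z) := by field_simp; ring
      rw [this]
      exact mul_nonneg (by positivity) (div_nonneg (sub_nonneg.2 (hPf z hz)) h3.le))
  have hPy : P y = f y := by simp [hP]
  simp only [hPy] at key
  have := Real.log_le_log (hfpos x (left_mem_Icc.2 hxy)) (hPf x (left_mem_Icc.2 hxy))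
  linarith

/-- The reverse of `log_sub_log_le`. -/
theorem le_log_sub_log (hf : IsInitialDatum f) {x y lam : ℝ} (hlam : 0 ≤ lam) (hx : 0 < x)
    (hxy : x ≤ y) (hy : y < 1)
    (h : ∀ z ∈ Icc x y, lam * (∫ u in z..y, f u ^ 2 / tail f u) ≤ f z - f y) :
    lam * (Real.log (tail f x) - Real.log (tail f y)) ≤ Real.log (f x) - Real.log (f y) := by
  set P : ℝ → ℝ := fun z => f y + lam * ∫ u in z..y, f u ^ 2 / tail f u with hP
  have hI : ∀ z ∈ Icc x y, z ∈ Ioo (0 : ℝ) 1 := fun z hz =>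
    ⟨hx.trans_le hz.1, hz.2.trans_lt hy⟩
  have hfpos : ∀ z ∈ Icc x y, 0 < f z := fun z hz => hf.pos z ⟨(hI z hz).1.le, (hI z hz).2⟩
  have htpos : ∀ z ∈ Icc x y, 0 < tail f z := fun z hz =>
    hf.tail_pos ⟨(hI z hz).1.le, (hI z hz).2⟩
  have hPf : ∀ z ∈ Icc x y, P z ≤ f z := fun z hz => by have := h z hz; simp only [hP]; linarith
  have hPpos : ∀ z ∈ Icc x y, 0 < P z := fun z hz => by
    have h1 := hfpos y (right_mem_Icc.2 hxy)
    have h2 : 0 ≤ ∫ u in z..y, f u ^ 2 / tail f u :=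
      intervalIntegral.integral_nonneg hz.2 fun u hu =>
        div_nonneg (sq_nonneg _) (htpos u ⟨hz.1.trans hu.1, hu.2⟩).le
    simp only [hP]
    positivity
  have key := le_of_hasDerivAt_nonpos
    (f := fun z => Real.log (P z) - lam * Real.log (tail f z))
    (f' := fun z => -(lam * (f z ^ 2 / tail f z)) / P z - lam * (-f z / tail f z)) hxy
    (fun z hz => ((hf.hasDerivAt_comparison hx hy hz).log (hPpos z hz).ne').sub
      (((hf.tail_hasDerivAt (hI z hz)).log (htpos z hz).ne').const_mul lam))
    (fun z hz => by
      have h1 := hfpos z hz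
      have h2 := htpos z hz
      have h3 := hPpos z hz
      have : -(lam * (f z ^ 2 / tail f z)) / P z - lam * (-f z / tail f z)
          = -(lam * (f z / tail f z) * ((f z - P z) / P z)) := by field_simp; ring
      rw [this]
      exact neg_nonpos.2
        (mul_nonneg (by positivity) (div_nonneg (sub_nonneg.2 (hPf z hz)) h3.le)))
  have hPy : P y = f y := by simp [hP]
  simp only [hPy] at key
  have := Real.log_le_log (hPpos x (left_mem_Icc.2 hxy)) (hPf x (left_mem_Icc.2 hxy))
  linarith

/-- For critical data, `log f` and `log h` have nearly equal increments near `1`. -/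
theorem exists_log_sub_log_near_one (hf : IsInitialDatum f)
    (hcrit : Tendsto (beta f) (𝓝[betaDomain f] 1) (𝓝 1)) {ε : ℝ} (hε : 0 < ε) (hε1 : ε ≤ 1) :
    ∃ x₀ ∈ Ioo (0 : ℝ) 1, ∀ x y, x₀ < x → x ≤ y → y < 1 →
      |(Real.log (f x) - Real.log (f y)) - (Real.log (tail f x) - Real.log (tail f y))| ≤
        ε * (Real.log (tail f x) - Real.log (tail f y)) := by
  obtain ⟨c, hi, hs, hae⟩ := hf.exists_density_ae
  obtain ⟨δ, hδ, hδ'⟩ := (Metric.tendsto_nhdsWithin_nhds.1 hcrit) ε hε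
  refine ⟨max (1 / 2) (1 - δ), ⟨by positivity, max_lt (by norm_num) (by linarith)⟩,
    fun x y hx hxy hy => ?_⟩
  have hx0 : 0 < x := by have := le_max_left (1 / 2 : ℝ) (1 - δ); linarith
  have hxδ : 1 - δ < x := (le_max_right _ _).trans_lt hx
  have hae' : ∀ᵐ u, u ∈ Icc x y → (1 - ε) * (f u ^ 2 / tail f u) ≤ c u ∧
      c u ≤ (1 + ε) * (f u ^ 2 / tail f u) := by
    filter_upwards [hae] with u hu huI
    have hu1 : u < 1 := huI.2.trans_lt hy
    obtain ⟨hb, hcu⟩ := hu ⟨hx0.trans_le huI.1, hu1⟩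
    have hd := hδ' hb (by
      rw [Real.dist_eq, abs_of_neg (by linarith)]; linarith [huI.1])
    rw [Real.dist_eq] at hd
    have hd := abs_lt.1 hd
    have hq : 0 ≤ f u ^ 2 / tail f u :=
      div_nonneg (sq_nonneg _) (hf.tail_pos ⟨(hx0.trans_le huI.1).le, hu1⟩).le
    rw [hcu]
    exact ⟨mul_le_mul_of_nonneg_right (by linarith) hq,
      mul_le_mul_of_nonneg_right (by linarith) hq⟩
  have hci : ∀ z ∈ Icc x y, IntervalIntegrable c volume z y := fun z hz => by
    refine hi.mono_set ?_
    rw [uIcc_of_le (zero_le_one' ℝ)]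
    exact uIcc_subset_Icc ⟨(hx0.trans_le hz.1).le, hz.2.trans hy.le⟩
      ⟨(hx0.trans_le hxy).le, hy.le⟩
  have hqi : ∀ z ∈ Icc x y, IntervalIntegrable (fun u => f u ^ 2 / tail f u) volume z y :=
    fun z hz => by
      refine (hf.continuousOn_sq_div_tail.mono ?_).intervalIntegrable
      rw [uIcc_of_le hz.2]
      exact fun u hu => ⟨(hx0.trans_le hz.1).trans_le hu.1, hu.2.trans_lt hy⟩
  have hI : ∀ z ∈ Icc x y, z ∈ Ico (0 : ℝ) 1 := fun z hz =>
    ⟨(hx0.trans_le hz.1).le, hz.2.trans_lt hy⟩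
  have hup := hf.log_sub_log_le (lam := 1 + ε) (by linarith) hx0 hxy hy fun z hz => by
    rw [hs z (hI z hz) y (hI y (right_mem_Icc.2 hxy)), ← intervalIntegral.integral_const_mul]
    refine intervalIntegral.integral_mono_ae_restrict hz.2 (hci z hz)
      ((hqi z hz).const_mul _) ?_
    rw [EventuallyLE, ae_restrict_iff' measurableSet_Icc]
    filter_upwards [hae'] with u hu huI using (hu ⟨hz.1.trans huI.1, huI.2⟩).2
  have hlo := hf.le_log_sub_log (lam := 1 - ε) (by linarith) hx0 hxy hy fun z hz => by
    rw [hs z (hI z hz) y (hI y (right_mem_Icc.2 hxy)), ← intervalIntegral.integral_const_mul]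
    refine intervalIntegral.integral_mono_ae_restrict hz.2
      ((hqi z hz).const_mul _) (hci z hz) ?_
    rw [EventuallyLE, ae_restrict_iff' measurableSet_Icc]
    filter_upwards [hae'] with u hu huI using (hu ⟨hz.1.trans huI.1, huI.2⟩).1
  rw [abs_le]
  constructor <;> linarith

/-- For critical data, `h / f = o(1 - x)` as `x → 1`. -/
theorem exists_tail_le_near_one (hf : IsInitialDatum f)
    (hcrit : Tendsto (beta f) (𝓝[betaDomain f] 1) (𝓝 1)) {ε : ℝ} (hε : 0 < ε) (hε1 : ε ≤ 1) :
    ∃ x₀ ∈ Ioo (0 : ℝ) 1, ∀ x, x₀ < x → x < 1 → tail f x ≤ ε * (1 - x) * f x := by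
  obtain ⟨x₀, hx₀, H⟩ := hf.exists_log_sub_log_near_one hcrit hε hε1
  refine ⟨x₀, hx₀, fun x hx hx1 => ?_⟩
  have hI : ∀ z, x ≤ z → z < 1 → z ∈ Ioo (0 : ℝ) 1 := fun z hz hz1 =>
    ⟨hx₀.1.trans (hx.trans_le hz), hz1⟩
  have hfpos : ∀ z, x ≤ z → z < 1 → 0 < f z := fun z hz hz1 =>
    hf.pos z ⟨(hI z hz hz1).1.le, hz1⟩
  have htpos : ∀ z, x ≤ z → z < 1 → 0 < tail f z := fun z hz hz1 =>
    hf.tail_pos ⟨(hI z hz hz1).1.le, hz1⟩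
  -- `h / f` is `ε`-Lipschitz near `1`, and it vanishes at `1`.
  have hlip : ∀ y, x ≤ y → y < 1 → tail f x / f x ≤ (1 - y) + ε * (1 - x) := by
    intro y hxy hy
    have := abs_sub_le_of_abs_log_sub_le (k := fun z => tail f z / f z)
      (l := fun z => -Real.log (tail f z)) hε.le hxy
      (fun z hz => div_pos (htpos z hz.1 (hz.2.trans_lt hy)) (hfpos z hz.1 (hz.2.trans_lt hy)))
      (fun z hz => ((hf.tail_hasDerivAt (hI z hz.1 (hz.2.trans_lt hy))).log
          (htpos z hz.1 (hz.2.trans_lt hy)).ne').neg.congr_deriv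
            (by rw [one_div_div, neg_div, neg_neg]))
      (fun a b ha hab hb => by
        have hb1 := hb.trans_lt hy
        have h := H a b (hx.trans_le ha) hab hb1
        rw [Real.log_div (htpos b (ha.trans hab) hb1).ne' (hfpos b (ha.trans hab) hb1).ne',
          Real.log_div (htpos a ha (hab.trans_lt hb1)).ne' (hfpos a ha (hab.trans_lt hb1)).ne']
        convert h using 2
        · ring
        · ring)
    have h1 := (abs_le.1 this).1
    have h2 : tail f y / f y ≤ 1 - y := by
      rw [div_le_iff₀ (hfpos y hxy hy)]
      exact hf.tail_le ⟨(hI y hxy hy).1.le, hy⟩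
    have h3 : ε * (y - x) ≤ ε * (1 - x) := by gcongr
    linarith
  have hle : tail f x / f x ≤ ε * (1 - x) := by
    refine le_of_forall_pos_le_add fun η hη => ?_
    have h1 := hlip (max x (1 - η)) (le_max_left _ _) (max_lt hx1 (by linarith))
    have := le_max_right x (1 - η)
    linarith
  rwa [div_le_iff₀ (hfpos x le_rfl hx1)] at hle

end IsInitialDatum

/-! ### The coordinate `v = 1 / (1 - x)` -/

/-- The function `f` in the coordinate `v = 1 / (1 - x) ∈ [1, ∞)`. -/
noncomputable def profile (f : ℝ → ℝ) (v : ℝ) : ℝ := f (1 - 1 / v)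

/-- `-log h` in the coordinate `v = 1 / (1 - x)`; a primitive of `1 / scale f`. -/
noncomputable def potential (f : ℝ → ℝ) (v : ℝ) : ℝ := -Real.log (tail f (1 - 1 / v))

/-- The length scale `v² h / f` on which `f` decays, in the coordinate `v = 1 / (1 - x)`.
Where `β` is defined, the logarithmic derivative of `profile f` is `-β / scale f`. -/
noncomputable def scale (f : ℝ → ℝ) (v : ℝ) : ℝ := v ^ 2 * tail f (1 - 1 / v) / profile f v

theorem one_sub_one_div_mem_Ico {v : ℝ} (hv : 1 ≤ v) : 1 - 1 / v ∈ Ico (0 : ℝ) 1 := by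
  have h0 : 0 < v := by linarith
  have h1 : 1 / v ≤ 1 := (div_le_one h0).2 hv
  have h2 : 0 < 1 / v := by positivity
  constructor <;> linarith

theorem one_sub_one_div_mem_Ioo {v : ℝ} (hv : 1 < v) : 1 - 1 / v ∈ Ioo (0 : ℝ) 1 := by
  have h1 : 1 / v < 1 := (div_lt_one (by linarith)).2 hv
  exact ⟨by linarith, (one_sub_one_div_mem_Ico hv.le).2⟩

theorem one_sub_one_div_le {v v' : ℝ} (hv : 0 < v) (h : v ≤ v') : 1 - 1 / v ≤ 1 - 1 / v' := by
  have := one_div_le_one_div_of_le hv h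
  linarith

theorem hasDerivAt_one_sub_one_div {v : ℝ} (hv : v ≠ 0) :
    HasDerivAt (fun v : ℝ => 1 - 1 / v) (1 / v ^ 2) v := by
  simpa [one_div] using (hasDerivAt_inv hv).const_sub 1

namespace IsInitialDatum

variable {f : ℝ → ℝ}

theorem profile_pos (hf : IsInitialDatum f) {v : ℝ} (hv : 1 ≤ v) : 0 < profile f v :=
  hf.pos _ (one_sub_one_div_mem_Ico hv)

theorem profile_antitone (hf : IsInitialDatum f) {v v' : ℝ} (hv : 1 ≤ v) (h : v ≤ v') :
    profile f v' ≤ profile f v :=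
  hf.antitoneOn (one_sub_one_div_mem_Ico hv) (one_sub_one_div_mem_Ico (hv.trans h))
    (one_sub_one_div_le (by linarith) h)

theorem continuousOn_profile (hf : IsInitialDatum f) : ContinuousOn (profile f) (Ici 1) :=
  hf.continuousOn.comp (t := Ico 0 1) (f := fun v : ℝ => 1 - 1 / v)
    (fun v (hv : 1 ≤ v) =>
      (hasDerivAt_one_sub_one_div (by linarith)).continuousAt.continuousWithinAt)
    (fun _ hv => one_sub_one_div_mem_Ico hv)

theorem scale_pos (hf : IsInitialDatum f) {v : ℝ} (hv : 1 ≤ v) : 0 < scale f v := by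
  have h1 := hf.profile_pos hv
  have h2 := hf.tail_pos (one_sub_one_div_mem_Ico hv)
  have h3 : 0 < v := by linarith
  rw [scale]
  positivity

theorem potential_hasDerivAt (hf : IsInitialDatum f) {v : ℝ} (hv : 1 < v) :
    HasDerivAt (potential f) (1 / scale f v) v := by
  have h1 := hf.tail_pos (one_sub_one_div_mem_Ico hv.le)
  have h2 := (hf.tail_hasDerivAt (one_sub_one_div_mem_Ioo hv)).comp v
    (hasDerivAt_one_sub_one_div (by linarith))
  refine (h2.log h1.ne').neg.congr_deriv ?_
  have h3 := hf.profile_pos hv.le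
  have h4 : 0 < v := by linarith
  simp only [scale, profile, Function.comp] at h3 ⊢
  field_simp

theorem log_scale (hf : IsInitialDatum f) {v : ℝ} (hv : 1 ≤ v) :
    Real.log (scale f v) = 2 * Real.log v - potential f v - Real.log (profile f v) := by
  have h1 := hf.profile_pos hv
  have h2 := hf.tail_pos (one_sub_one_div_mem_Ico hv)
  have h3 : 0 < v := by linarith
  rw [scale, Real.log_div (by positivity) h1.ne', Real.log_mul (by positivity) h2.ne',
    Real.log_pow, potential]
  push_cast
  ring

theorem potential_mono (hf : IsInitialDatum f) {v v' : ℝ} (hv : 1 < v) (h : v ≤ v') :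
    potential f v ≤ potential f v' :=
  le_of_hasDerivAt_nonneg h (fun _ hz => hf.potential_hasDerivAt (hv.trans_le hz.1))
    fun _ hz => one_div_nonneg.2 (hf.scale_pos (hv.le.trans hz.1)).le

/-- For critical data, `profile f` decays like an exponential on the length scale `scale f`, which
itself varies slowly. -/
theorem eventually_slowly_varying (hf : IsInitialDatum f)
    (hcrit : Tendsto (beta f) (𝓝[betaDomain f] 1) (𝓝 1)) {ε : ℝ} (hε : 0 < ε) :
    ∀ᶠ V in atTop, 1 < V ∧ ∀ v v', V ≤ v → v ≤ v' →
      |(Real.log (profile f v) - Real.log (profile f v')) - (potential f v' - potential f v)| ≤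
        ε * (potential f v' - potential f v) ∧
      |Real.log (scale f v') - Real.log (scale f v)| ≤ ε * (potential f v' - potential f v) ∧
      |scale f v' - scale f v| ≤ ε * (v' - v) := by
  have hη : 0 < min (ε / 3) 1 := lt_min (by linarith) one_pos
  set η := min (ε / 3) 1
  have hη3 : 3 * η ≤ ε := by have := min_le_left (ε / 3) 1; simp only [η]; linarith
  obtain ⟨x₁, hx₁, H1⟩ := hf.exists_log_sub_log_near_one hcrit hη (min_le_right _ _)
  obtain ⟨x₂, hx₂, H2⟩ := hf.exists_tail_le_near_one hcrit hη (min_le_right _ _)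
  filter_upwards [eventually_gt_atTop (1 : ℝ), eventually_gt_atTop (1 / (1 - x₁)),
    eventually_gt_atTop (1 / (1 - x₂))] with V hV1 hVx₁ hVx₂
  have hgt : ∀ x : ℝ, x < 1 → 1 / (1 - x) < V → ∀ v, V ≤ v → x < 1 - 1 / v := by
    intro x hx hxV v hv
    have := one_div_lt_one_div_of_lt (one_div_pos.2 (sub_pos.2 hx)) (hxV.trans_le hv)
    rw [one_div_one_div] at this
    linarith
  have hS : ∀ v v', V ≤ v → v ≤ v' →
      |(Real.log (profile f v) - Real.log (profile f v')) - (potential f v' - potential f v)| ≤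
        η * (potential f v' - potential f v) := by
    intro v v' hv hvv'
    have h0 : 0 < v := by linarith
    have := H1 (1 - 1 / v) (1 - 1 / v') (hgt x₁ hx₁.2 hVx₁ v hv) (one_sub_one_div_le h0 hvv')
      (one_sub_one_div_mem_Ico (by linarith)).2
    simp only [potential, profile]
    convert this using 2 <;> ring
  have hρ : ∀ v, V ≤ v → scale f v ≤ η * v := by
    intro v hv
    have h0 : 0 < v := by linarith
    have h1 := H2 _ (hgt x₂ hx₂.2 hVx₂ v hv) (one_sub_one_div_mem_Ico (by linarith)).2
    rw [scale, div_le_iff₀ (hf.profile_pos (by linarith)), profile]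
    calc v ^ 2 * tail f (1 - 1 / v) ≤ v ^ 2 * (η * (1 - (1 - 1 / v)) * f (1 - 1 / v)) := by gcongr
      _ = η * v * f (1 - 1 / v) := by field_simp; ring
  -- `(log v)' = (scale f v / v) * (potential f)'`, and `scale f v / v` is small.
  have hlogv : ∀ v v', V ≤ v → v ≤ v' →
      Real.log v' - Real.log v ≤ η * (potential f v' - potential f v) := by
    intro v v' hv hvv'
    have := le_of_hasDerivAt_nonneg (f := fun z => η * potential f z - Real.log z)
      (f' := fun z => η * (1 / scale f z) - z⁻¹) hvv'
      (fun z hz => ((hf.potential_hasDerivAt (by linarith [hz.1])).const_mul η).sub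
        (Real.hasDerivAt_log (by linarith [hz.1])))
      (fun z hz => by
        have h0 : 0 < z := by linarith [hz.1]
        have h1 := hf.scale_pos (v := z) (by linarith [hz.1])
        have h2 := hρ z (hv.trans hz.1)
        rw [sub_nonneg, mul_one_div, inv_eq_one_div, div_le_div_iff₀ h0 h1]
        linarith)
    linarith
  have hL : ∀ v v', V ≤ v → v ≤ v' →
      |Real.log (scale f v') - Real.log (scale f v)| ≤ ε * (potential f v' - potential f v) := by
    intro v v' hv hvv'
    have h1 := abs_le.1 (hS v v' hv hvv')
    have h2 := hlogv v v' hv hvv'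
    have h3 := Real.log_le_log (by linarith) hvv'
    have h4 := hf.potential_mono (v := v) (by linarith) hvv'
    have h5 : 3 * η * (potential f v' - potential f v) ≤ ε * (potential f v' - potential f v) :=
      mul_le_mul_of_nonneg_right hη3 (by linarith)
    rw [hf.log_scale (by linarith), hf.log_scale (by linarith), abs_le]
    constructor <;> linarith
  refine ⟨hV1, fun v v' hv hvv' => ⟨?_, hL v v' hv hvv', ?_⟩⟩
  · have h4 := hf.potential_mono (v := v) (by linarith) hvv'
    exact (hS v v' hv hvv').trans (mul_le_mul_of_nonneg_right (by linarith) (by linarith))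
  · exact abs_sub_le_of_abs_log_sub_le hε.le hvv'
      (fun z hz => hf.scale_pos (by linarith [hz.1]))
      (fun z hz => hf.potential_hasDerivAt (by linarith [hz.1]))
      (fun a b ha hab _ => hL a b (hv.trans ha) hab)

end IsInitialDatum

/-! ### Convergence of the rescaled profile to the exponential -/

/-- The function `f` near `v`, normalized to be `1` at `v`, in the unit of length `scale f v`. -/
noncomputable def rescaled (f : ℝ → ℝ) (v s : ℝ) : ℝ :=
  profile f (v + scale f v * s) / profile f v

/-- The weighted integral `∫₀^∞ X(s) / (1 + q s)² ds`, which expresses both the mass and the beta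
function after rescaling. -/
noncomputable def weighted (X : ℝ → ℝ) (q : ℝ) : ℝ := ∫ s in Ioi (0 : ℝ), X s / (1 + q * s) ^ 2

namespace IsInitialDatum

variable {f : ℝ → ℝ}

theorem le_add_scale_mul (hf : IsInitialDatum f) {v s : ℝ} (hv : 1 ≤ v) (hs : 0 ≤ s) :
    v ≤ v + scale f v * s := by
  have := mul_nonneg (hf.scale_pos hv).le hs
  linarith

theorem rescaled_pos (hf : IsInitialDatum f) {v s : ℝ} (hv : 1 ≤ v) (hs : 0 ≤ s) :
    0 < rescaled f v s :=
  div_pos (hf.profile_pos (hv.trans (hf.le_add_scale_mul hv hs))) (hf.profile_pos hv)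

theorem rescaled_eq_exp (hf : IsInitialDatum f) {v s : ℝ} (hv : 1 ≤ v) (hs : 0 ≤ s) :
    rescaled f v s = Real.exp
      (-(Real.log (profile f v) - Real.log (profile f (v + scale f v * s)))) := by
  rw [neg_sub, Real.exp_sub, Real.exp_log (hf.profile_pos hv),
    Real.exp_log (hf.profile_pos (hv.trans (hf.le_add_scale_mul hv hs))), rescaled]

theorem continuousOn_rescaled (hf : IsInitialDatum f) {v : ℝ} (hv : 1 ≤ v) :
    ContinuousOn (rescaled f v) (Ici 0) :=
  (hf.continuousOn_profile.comp (t := Ici 1) (f := fun s => v + scale f v * s)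
    (by fun_prop) (fun _ hs => hv.trans (hf.le_add_scale_mul hv hs))).div_const _

theorem potential_add_hasDerivAt (hf : IsInitialDatum f) {v s : ℝ} (hv : 1 < v) (hs : 0 ≤ s) :
    HasDerivAt (fun s => potential f (v + scale f v * s))
      (scale f v / scale f (v + scale f v * s)) s := by
  have h1 := hf.potential_hasDerivAt (hv.trans_le (hf.le_add_scale_mul hv.le hs))
  have h2 : HasDerivAt (fun s => v + scale f v * s) (scale f v) s := by
    simpa using ((hasDerivAt_id s).const_mul (scale f v)).const_add v
  refine (h1.comp s h2).congr_deriv ?_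
  ring

/-- The domination `X_v(s) ≤ (1 + s/4)⁻³ ≤ 16 / (1 + s²)`. -/
theorem eventually_rescaled_le (hf : IsInitialDatum f)
    (hcrit : Tendsto (beta f) (𝓝[betaDomain f] 1) (𝓝 1)) :
    ∀ᶠ v in atTop, ∀ s, 0 ≤ s → rescaled f v s ≤ 16 * (1 + s ^ 2)⁻¹ := by
  filter_upwards [hf.eventually_slowly_varying hcrit (ε := 1 / 4) (by norm_num)]
    with v ⟨hv, H⟩ s hs
  have hρ := hf.scale_pos hv.le
  have h1 := le_of_hasDerivAt_nonneg
    (f := fun t => potential f (v + scale f v * t) - 4 * Real.log (1 + 1 / 4 * t))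
    (f' := fun t => scale f v / scale f (v + scale f v * t) - 4 * (1 / 4 * 1 / (1 + 1 / 4 * t)))
    hs
    (fun t ht => (hf.potential_add_hasDerivAt hv ht.1).sub
      (((((hasDerivAt_id t).const_mul (1 / 4)).const_add 1).log
        (by have := ht.1; simp only [id]; positivity)).const_mul 4))
    (fun t ht => by
      have ht0 := ht.1
      have h2 := (abs_le.1 (H v _ le_rfl (hf.le_add_scale_mul hv.le ht0)).2.2).2
      have h3 := hf.scale_pos (hv.le.trans (hf.le_add_scale_mul hv.le ht0))
      rw [sub_nonneg, show 4 * (1 / 4 * 1 / (1 + 1 / 4 * t)) = 1 / (1 + 1 / 4 * t) by ring,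
        div_le_div_iff₀ (by positivity) h3]
      nlinarith)
  have h2 := (abs_le.1 (H v _ le_rfl (hf.le_add_scale_mul hv.le hs)).1).1
  have h3 : 0 < 1 + 1 / 4 * s := by positivity
  simp only [mul_zero, add_zero, Real.log_one, sub_zero] at h1
  rw [hf.rescaled_eq_exp hv.le hs]
  calc _ ≤ Real.exp (-(3 * Real.log (1 + 1 / 4 * s))) := Real.exp_le_exp.2 (by linarith)
    _ = ((1 + 1 / 4 * s) ^ 3)⁻¹ := by
      rw [Real.exp_neg, show (3 : ℝ) = ((3 : ℕ) : ℝ) by norm_num, Real.exp_nat_mul,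
        Real.exp_log h3]
    _ ≤ 16 * (1 + s ^ 2)⁻¹ := by
      rw [inv_eq_one_div, ← div_eq_mul_inv, div_le_div_iff₀ (by positivity) (by positivity)]
      nlinarith [mul_nonneg hs hs, mul_nonneg (mul_nonneg hs hs) hs]

theorem tendsto_rescaled (hf : IsInitialDatum f)
    (hcrit : Tendsto (beta f) (𝓝[betaDomain f] 1) (𝓝 1)) {s : ℝ} (hs : 0 ≤ s) :
    Tendsto (fun v => rescaled f v s) atTop (𝓝 (Real.exp (-s))) := by
  have hlow : Tendsto (fun ε : ℝ => Real.exp (-((1 + ε) * (s / (1 - ε * s))))) (𝓝[>] 0)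
      (𝓝 (Real.exp (-s))) := by
    have : ContinuousAt (fun ε : ℝ => Real.exp (-((1 + ε) * (s / (1 - ε * s))))) 0 := by
      refine Real.continuous_exp.continuousAt.comp (ContinuousAt.neg ?_)
      exact ContinuousAt.mul (by fun_prop)
        (continuousAt_const.div (by fun_prop) (by norm_num))
    have h := this.tendsto.mono_left (nhdsWithin_le_nhds (s := Ioi 0))
    simpa using h
  have hupp : Tendsto (fun ε : ℝ => Real.exp (-((1 - ε) * (s / (1 + ε * s))))) (𝓝[>] 0)
      (𝓝 (Real.exp (-s))) := by
    have : ContinuousAt (fun ε : ℝ => Real.exp (-((1 - ε) * (s / (1 + ε * s))))) 0 := by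
      refine Real.continuous_exp.continuousAt.comp (ContinuousAt.neg ?_)
      exact ContinuousAt.mul (by fun_prop)
        (continuousAt_const.div (by fun_prop) (by norm_num))
    have h := this.tendsto.mono_left (nhdsWithin_le_nhds (s := Ioi 0))
    simpa using h
  have hsmall : ∀ᶠ ε : ℝ in 𝓝[>] 0, ε * s < 1 := by
    have : Tendsto (fun ε : ℝ => ε * s) (𝓝[>] 0) (𝓝 0) := by
      have h := (continuous_mul_const s).tendsto (0 : ℝ)
      rw [zero_mul] at h
      exact h.mono_left nhdsWithin_le_nhds
    exact this.eventually (gt_mem_nhds one_pos)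
  have hone : ∀ᶠ ε : ℝ in 𝓝[>] 0, ε < 1 :=
    nhdsWithin_le_nhds (gt_mem_nhds one_pos)
  refine tendsto_order.2 ⟨fun a ha => ?_, fun a ha => ?_⟩
  · obtain ⟨ε, h1, h2, hε⟩ := ((hlow.eventually (lt_mem_nhds ha)).and
      (hsmall.and self_mem_nhdsWithin)).exists
    have hε : 0 < ε := hε
    filter_upwards [hf.eventually_slowly_varying hcrit hε] with v ⟨hv, H⟩
    refine h1.trans_le ?_
    have hρ := hf.scale_pos hv.le
    have h3 := le_of_hasDerivAt_nonpos
      (f := fun t => potential f (v + scale f v * t) - 1 / (1 - ε * s) * t)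
      (f' := fun t => scale f v / scale f (v + scale f v * t) - 1 / (1 - ε * s) * 1) hs
      (fun t ht => (hf.potential_add_hasDerivAt hv ht.1).sub ((hasDerivAt_id t).const_mul _))
      (fun t ht => by
        have h4 := (abs_le.1 (H v _ le_rfl (hf.le_add_scale_mul hv.le ht.1)).2.2).1
        have h5 := hf.scale_pos (hv.le.trans (hf.le_add_scale_mul hv.le ht.1))
        have h6 : ε * (scale f v * t) ≤ ε * (scale f v * s) := by have := ht.2; gcongr
        rw [sub_nonpos, mul_one, div_le_div_iff₀ h5 (by linarith)]
        linarith)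
    have h4 := (abs_le.1 (H v _ le_rfl (hf.le_add_scale_mul hv.le hs)).1).2
    simp only [mul_zero, add_zero, sub_zero] at h3
    rw [hf.rescaled_eq_exp hv.le hs, Real.exp_le_exp, neg_le_neg_iff]
    have h5 : potential f (v + scale f v * s) - potential f v ≤ s / (1 - ε * s) := by
      rw [div_eq_mul_one_div s, mul_comm s]; linarith
    have h6 : (1 + ε) * (potential f (v + scale f v * s) - potential f v) ≤
      (1 + ε) * (s / (1 - ε * s)) := by gcongr
    linarith
  · obtain ⟨ε, h1, h2, hε⟩ := ((hupp.eventually (gt_mem_nhds ha)).and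
      (hone.and self_mem_nhdsWithin)).exists
    have hε : 0 < ε := hε
    filter_upwards [hf.eventually_slowly_varying hcrit hε] with v ⟨hv, H⟩
    refine lt_of_le_of_lt ?_ h1
    have hρ := hf.scale_pos hv.le
    have h3 := le_of_hasDerivAt_nonneg
      (f := fun t => potential f (v + scale f v * t) - 1 / (1 + ε * s) * t)
      (f' := fun t => scale f v / scale f (v + scale f v * t) - 1 / (1 + ε * s) * 1) hs
      (fun t ht => (hf.potential_add_hasDerivAt hv ht.1).sub ((hasDerivAt_id t).const_mul _))
      (fun t ht => by
        have h4 := (abs_le.1 (H v _ le_rfl (hf.le_add_scale_mul hv.le ht.1)).2.2).2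
        have h5 := hf.scale_pos (hv.le.trans (hf.le_add_scale_mul hv.le ht.1))
        have h6 : ε * (scale f v * t) ≤ ε * (scale f v * s) := by have := ht.2; gcongr
        rw [sub_nonneg, mul_one, div_le_div_iff₀ (by positivity) h5]
        linarith)
    have h4 := (abs_le.1 (H v _ le_rfl (hf.le_add_scale_mul hv.le hs)).1).1
    simp only [mul_zero, add_zero, sub_zero] at h3
    rw [hf.rescaled_eq_exp hv.le hs, Real.exp_le_exp, neg_le_neg_iff]
    have h5 : s / (1 + ε * s) ≤ potential f (v + scale f v * s) - potential f v := by
      rw [div_eq_mul_one_div s, mul_comm s]; linarith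
    have h6 : (1 - ε) * (s / (1 + ε * s)) ≤
      (1 - ε) * (potential f (v + scale f v * s) - potential f v) := by
        have : 0 ≤ 1 - ε := by linarith
        gcongr
    linarith

theorem eventually_integrableOn_rescaled (hf : IsInitialDatum f)
    (hcrit : Tendsto (beta f) (𝓝[betaDomain f] 1) (𝓝 1)) :
    ∀ᶠ v in atTop, 1 < v ∧ IntegrableOn (rescaled f v) (Ioi 0) := by
  filter_upwards [hf.eventually_rescaled_le hcrit, eventually_gt_atTop 1] with v hv hv1
  refine ⟨hv1, Integrable.mono' (integrable_inv_one_add_sq.const_mul 16).integrableOn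
    (((hf.continuousOn_rescaled hv1.le).mono Ioi_subset_Ici_self).aestronglyMeasurable
      measurableSet_Ioi) ?_⟩
  refine (ae_restrict_mem measurableSet_Ioi).mono fun s (hs : 0 < s) => ?_
  rw [Real.norm_eq_abs, abs_of_pos (hf.rescaled_pos hv1.le hs.le)]
  exact hv s hs.le

/-- The rescaled profiles converge to the exponential in `L¹`. -/
theorem tendsto_integral_abs_rescaled_sub_exp (hf : IsInitialDatum f)
    (hcrit : Tendsto (beta f) (𝓝[betaDomain f] 1) (𝓝 1)) :
    Tendsto (fun v => ∫ s in Ioi (0 : ℝ), |rescaled f v s - Real.exp (-s)|) atTop (𝓝 0) := by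
  have hexp : IntegrableOn (fun s : ℝ => Real.exp (-s)) (Ioi 0) := integrableOn_exp_neg_Ioi 0
  have := tendsto_integral_filter_of_dominated_convergence (μ := volume.restrict (Ioi (0 : ℝ)))
    (l := atTop) (F := fun v s => |rescaled f v s - Real.exp (-s)|) (f := fun _ => (0 : ℝ))
    (fun s => 16 * (1 + s ^ 2)⁻¹ + Real.exp (-s)) ?_ ?_
    ((integrable_inv_one_add_sq.const_mul 16).integrableOn.add hexp) ?_
  · simpa using this
  · filter_upwards [hf.eventually_integrableOn_rescaled hcrit] with v hv
    exact (hv.2.sub hexp).abs.aestronglyMeasurable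
  · filter_upwards [hf.eventually_rescaled_le hcrit, eventually_gt_atTop 1] with v hv hv1
    refine (ae_restrict_mem measurableSet_Ioi).mono fun s (hs : 0 < s) => ?_
    have h1 := hv s hs.le
    have h2 := hf.rescaled_pos hv1.le hs.le
    have h3 := Real.exp_pos (-s)
    have h4 : 0 ≤ 16 * (1 + s ^ 2)⁻¹ := by positivity
    rw [Real.norm_eq_abs, abs_abs, abs_le]
    constructor <;> linarith
  · refine (ae_restrict_mem measurableSet_Ioi).mono fun s (hs : 0 < s) => ?_
    have := ((hf.tendsto_rescaled hcrit hs.le).sub_const (Real.exp (-s))).abs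
    simpa using this

end IsInitialDatum

/-! ### Weighted integrals -/

section Weighted

variable {X Y : ℝ → ℝ}

theorem integrableOn_weighted (hX : IntegrableOn X (Ioi 0)) {q : ℝ} (hq : 0 ≤ q) :
    IntegrableOn (fun s => X s / (1 + q * s) ^ 2) (Ioi 0) := by
  refine Integrable.mono hX (hX.aestronglyMeasurable.div₀ ?_) ?_
  · exact (by fun_prop : Continuous fun s : ℝ => (1 + q * s) ^ 2).aestronglyMeasurable
  · refine (ae_restrict_mem measurableSet_Ioi).mono fun s (hs : 0 < s) => ?_
    have h : 1 ≤ (1 + q * s) ^ 2 := one_le_pow₀ (by have := mul_nonneg hq hs.le; linarith)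
    rw [norm_div, Real.norm_eq_abs ((1 + q * s) ^ 2), abs_of_pos (by linarith)]
    exact div_le_self (norm_nonneg _) h

theorem abs_weighted_sub_le (hX : IntegrableOn X (Ioi 0)) (hY : IntegrableOn Y (Ioi 0)) {q : ℝ}
    (hq : 0 ≤ q) : |weighted X q - weighted Y q| ≤ ∫ s in Ioi (0 : ℝ), |X s - Y s| := by
  rw [weighted, weighted, ← integral_sub (integrableOn_weighted hX hq) (integrableOn_weighted hY hq)]
  refine abs_integral_le_integral_abs.trans ?_
  refine setIntegral_mono_on
    ((integrableOn_weighted hX hq).sub (integrableOn_weighted hY hq)).abs (hX.sub hY).abs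
    measurableSet_Ioi fun s (hs : 0 < s) => ?_
  have h : 1 ≤ (1 + q * s) ^ 2 := one_le_pow₀ (by have := mul_nonneg hq hs.le; linarith)
  rw [← sub_div, abs_div, abs_of_pos (a := (1 + q * s) ^ 2) (by linarith)]
  exact div_le_self (abs_nonneg _) h

theorem weighted_pos (hX : IntegrableOn X (Ioi 0)) (hpos : ∀ s, 0 < s → 0 < X s) {q : ℝ}
    (hq : 0 ≤ q) : 0 < weighted X q := by
  have hp : ∀ s ∈ Ioi (0 : ℝ), 0 < X s / (1 + q * s) ^ 2 := fun s (hs : 0 < s) => by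
    have := hpos s hs
    positivity
  rw [weighted, setIntegral_pos_iff_support_of_nonneg_ae
    ((ae_restrict_mem measurableSet_Ioi).mono fun s hs => (hp s hs).le)
    (integrableOn_weighted hX hq)]
  rw [inter_eq_self_of_subset_right
    (show Ioi (0 : ℝ) ⊆ Function.support _ from fun s hs => (hp s hs).ne')]
  simp

/-- `q² / (1 + q s)²` increases with `q`. -/
theorem sq_mul_weighted_le (hX : IntegrableOn X (Ioi 0)) (hpos : ∀ s, 0 < s → 0 < X s) {a q : ℝ}
    (ha : 0 ≤ a) (haq : a ≤ q) : a ^ 2 * weighted X a ≤ q ^ 2 * weighted X q := by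
  have hq := ha.trans haq
  rw [weighted, weighted, ← integral_const_mul, ← integral_const_mul]
  refine setIntegral_mono_on ((integrableOn_weighted hX ha).const_mul _)
    ((integrableOn_weighted hX hq).const_mul _) measurableSet_Ioi fun s (hs : 0 < s) => ?_
  have h1 := hpos s hs
  rw [mul_div_assoc', mul_div_assoc', div_le_div_iff₀ (by positivity) (by positivity)]
  have h2 : a * (1 + q * s) ≤ q * (1 + a * s) := by nlinarith
  have h3 : (a * (1 + q * s)) ^ 2 ≤ (q * (1 + a * s)) ^ 2 := by gcongr
  nlinarith

theorem integrableOn_exp_neg : IntegrableOn (fun s : ℝ => Real.exp (-s)) (Ioi 0) :=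
  integrableOn_exp_neg_Ioi 0

theorem weighted_exp_le_one {q : ℝ} (hq : 0 ≤ q) : weighted (fun s => Real.exp (-s)) q ≤ 1 := by
  rw [weighted]
  refine le_of_le_of_eq ?_ integral_exp_neg_Ioi_zero
  refine setIntegral_mono_on (integrableOn_weighted integrableOn_exp_neg hq) integrableOn_exp_neg
    measurableSet_Ioi fun s (hs : 0 < s) => ?_
  exact div_le_self (Real.exp_pos _).le
    (one_le_pow₀ (by have := mul_nonneg hq hs.le; linarith))

theorem abs_inv_sq_sub_inv_sq_le {q r s : ℝ} (hq : 0 ≤ q) (hr : 0 ≤ r) (hs : 0 ≤ s) :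
    |1 / (1 + q * s) ^ 2 - 1 / (1 + r * s) ^ 2| ≤ 2 * |q - r| * s := by
  have hqs : 0 ≤ q * s := mul_nonneg hq hs
  have hrs : 0 ≤ r * s := mul_nonneg hr hs
  have h1 : 1 / (1 + q * s) ^ 2 - 1 / (1 + r * s) ^ 2 =
      -((q - r) * s) *
        (1 / ((1 + q * s) ^ 2 * (1 + r * s)) + 1 / ((1 + q * s) * (1 + r * s) ^ 2)) := by
    field_simp
    ring
  have h2 : 1 / ((1 + q * s) ^ 2 * (1 + r * s)) ≤ 1 := by
    rw [div_le_one (by positivity)]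
    exact one_le_mul_of_one_le_of_one_le (one_le_pow₀ (by linarith)) (by linarith)
  have h3 : 1 / ((1 + q * s) * (1 + r * s) ^ 2) ≤ 1 := by
    rw [div_le_one (by positivity)]
    exact one_le_mul_of_one_le_of_one_le (by linarith) (one_le_pow₀ (by linarith))
  have h4 : 0 ≤ 1 / ((1 + q * s) ^ 2 * (1 + r * s)) + 1 / ((1 + q * s) * (1 + r * s) ^ 2) := by
    positivity
  rw [h1, abs_mul, abs_neg, abs_mul, abs_of_nonneg hs, abs_of_nonneg h4]
  have := mul_le_mul_of_nonneg_left (add_le_add h2 h3) (mul_nonneg (abs_nonneg (q - r)) hs)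
  linarith

theorem abs_weighted_exp_sub_le {q r : ℝ} (hq : 0 ≤ q) (hr : 0 ≤ r) :
    |weighted (fun s => Real.exp (-s)) q - weighted (fun s => Real.exp (-s)) r| ≤
      2 * |q - r| := by
  have hint : IntegrableOn (fun s : ℝ => Real.exp (-s) * s) (Ioi 0) := by
    simpa [show (2 : ℝ) - 1 = 1 by norm_num] using
      Real.GammaIntegral_convergent (s := 2) two_pos
  have hval : ∫ s in Ioi (0 : ℝ), Real.exp (-s) * s = 1 := by
    have := Real.Gamma_eq_integral (s := 2) two_pos
    rw [Real.Gamma_two] at this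
    simpa [show (2 : ℝ) - 1 = 1 by norm_num] using this.symm
  have h1 := integrableOn_weighted integrableOn_exp_neg hq
  have h2 := integrableOn_weighted integrableOn_exp_neg hr
  rw [weighted, weighted, ← integral_sub h1 h2]
  refine abs_integral_le_integral_abs.trans ?_
  calc _ ≤ ∫ s in Ioi (0 : ℝ), 2 * |q - r| * (Real.exp (-s) * s) := by
        refine setIntegral_mono_on (h1.sub h2).abs (hint.const_mul _) measurableSet_Ioi
          fun s (hs : 0 < s) => ?_
        rw [div_eq_mul_one_div, div_eq_mul_one_div (Real.exp (-s)) ((1 + r * s) ^ 2), ← mul_sub,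
          abs_mul, abs_of_pos (Real.exp_pos _)]
        have := mul_le_mul_of_nonneg_left (abs_inv_sq_sub_inv_sq_le hq hr hs.le)
          (Real.exp_pos (-s)).le
        linarith
    _ = 2 * |q - r| := by rw [integral_const_mul, hval, mul_one]

/-- The quantity `-c log q - log ∫₀^∞ X(s) / (1 + q s)² ds`. By conservation of mass its
increments along a solution can be computed, and for `X > 0`, `c > 2` it is strictly decreasing in
`q > 0`. -/
noncomputable def energy (c : ℝ) (X : ℝ → ℝ) (q : ℝ) : ℝ :=
  -(c * Real.log q) - Real.log (weighted X q)

theorem energy_sub_le (hX : IntegrableOn X (Ioi 0)) (hpos : ∀ s, 0 < s → 0 < X s) {c a q : ℝ}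
    (ha : 0 < a) (haq : a ≤ q) :
    energy c X q - energy c X a ≤ -((c - 2) * (Real.log q - Real.log a)) := by
  have h1 := sq_mul_weighted_le hX hpos ha.le haq
  have hq := ha.trans_le haq
  have ha' := weighted_pos hX hpos ha.le
  have hq' := weighted_pos hX hpos hq.le
  have h2 := Real.log_le_log (by positivity) h1
  rw [Real.log_mul (by positivity) ha'.ne', Real.log_mul (by positivity) hq'.ne', Real.log_pow,
    Real.log_pow] at h2
  push_cast at h2
  simp only [energy]
  linarith

theorem energy_anti (hX : IntegrableOn X (Ioi 0)) (hpos : ∀ s, 0 < s → 0 < X s) {c a q : ℝ}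
    (hc : 2 < c) (ha : 0 < a) (haq : a ≤ q) : energy c X q ≤ energy c X a := by
  have h1 := energy_sub_le (c := c) hX hpos ha haq
  have h2 := mul_nonneg (sub_pos.2 hc).le (sub_nonneg.2 (Real.log_le_log ha haq))
  linarith

theorem energy_exp_lt {c a q : ℝ} (hc : 2 < c) (ha : 0 < a) (haq : a < q) :
    energy c (fun s => Real.exp (-s)) q < energy c (fun s => Real.exp (-s)) a := by
  have h1 := energy_sub_le (c := c) integrableOn_exp_neg (fun s _ => Real.exp_pos (-s)) ha haq.le
  have h2 := mul_pos (sub_pos.2 hc) (sub_pos.2 (Real.log_lt_log ha haq))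
  linarith

end Weighted

theorem IsInitialDatum.tendsto_weighted_rescaled {f : ℝ → ℝ} (hf : IsInitialDatum f)
    (hcrit : Tendsto (beta f) (𝓝[betaDomain f] 1) (𝓝 1)) {q : ℝ} (hq : 0 ≤ q) :
    Tendsto (fun v => weighted (rescaled f v) q) atTop
      (𝓝 (weighted (fun s => Real.exp (-s)) q)) := by
  rw [tendsto_iff_dist_tendsto_zero]
  refine squeeze_zero' (Eventually.of_forall fun _ => dist_nonneg) ?_
    (hf.tendsto_integral_abs_rescaled_sub_exp hcrit)
  filter_upwards [hf.eventually_integrableOn_rescaled hcrit] with v hv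
  exact abs_weighted_sub_le hv.2 integrableOn_exp_neg hq

theorem IsInitialDatum.tendsto_energy_rescaled {f : ℝ → ℝ} (hf : IsInitialDatum f)
    (hcrit : Tendsto (beta f) (𝓝[betaDomain f] 1) (𝓝 1)) (c : ℝ) {q : ℝ} (hq : 0 < q) :
    Tendsto (fun v => energy c (rescaled f v) q) atTop
      (𝓝 (energy c (fun s => Real.exp (-s)) q)) :=
  ((hf.tendsto_weighted_rescaled hcrit hq.le).log
    (weighted_pos integrableOn_exp_neg (fun s _ => Real.exp_pos (-s)) hq.le).ne').const_sub _

/-! ### Change of variables in the tail integral -/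

theorem image_one_sub_one_div {u c : ℝ} (hu : 0 < u) (hc : 0 < c) :
    (fun s => 1 - 1 / (u + c * s)) '' Ioi 0 = Ioo (1 - 1 / u) 1 := by
  ext z
  simp only [mem_image, mem_Ioi, mem_Ioo]
  constructor
  · rintro ⟨s, hs, rfl⟩
    have h1 : 0 < c * s := mul_pos hc hs
    have h2 := one_div_lt_one_div_of_lt hu (by linarith : u < u + c * s)
    have h3 : 0 < 1 / (u + c * s) := by positivity
    constructor <;> linarith
  · rintro ⟨h1, h2⟩
    have h3 : 0 < 1 - z := by linarith
    have h4 := one_div_lt_one_div_of_lt h3 (by linarith : 1 - z < 1 / u)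
    rw [one_div_one_div] at h4
    refine ⟨(1 / (1 - z) - u) / c, div_pos (by linarith) hc, ?_⟩
    rw [mul_div_cancel₀ _ hc.ne', add_sub_cancel, one_div_one_div]
    ring

theorem integral_eq_integral_Ioi {u c : ℝ} (hu : 0 < u) (hc : 0 < c) (g : ℝ → ℝ) :
    ∫ z in (1 - 1 / u)..1, g z =
      ∫ s in Ioi (0 : ℝ), c / (u + c * s) ^ 2 * g (1 - 1 / (u + c * s)) := by
  have hle : 1 - 1 / u ≤ 1 := by have : 0 < 1 / u := by positivity
                                 linarith
  have hpos : ∀ s ∈ Ioi (0 : ℝ), 0 < u + c * s := fun s (hs : 0 < s) => by positivity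
  rw [intervalIntegral.integral_of_le hle, integral_Ioc_eq_integral_Ioo,
    ← image_one_sub_one_div hu hc,
    integral_image_eq_integral_abs_deriv_smul (f' := fun s => c / (u + c * s) ^ 2)
      measurableSet_Ioi (fun s hs => ?_) (fun s hs t ht hst => ?_)]
  · refine setIntegral_congr_fun measurableSet_Ioi fun s hs => ?_
    have := hpos s hs
    simp only [smul_eq_mul]
    rw [abs_of_pos (by positivity)]
  · have h2 : HasDerivAt (fun s => u + c * s) c s := by
      simpa using ((hasDerivAt_id s).const_mul c).const_add u
    refine HasDerivAt.hasDerivWithinAt ?_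
    refine ((hasDerivAt_one_sub_one_div (hpos s hs).ne').comp s h2).congr_deriv ?_
    ring
  · have h1 := hpos s hs
    have h2 := hpos t ht
    have h3 : 1 / (u + c * s) = 1 / (u + c * t) := by simpa using hst
    rw [div_eq_div_iff h1.ne' h2.ne'] at h3
    exact mul_left_cancel₀ hc.ne' (by linarith)

/-- The tail of a function which is a multiple of `X` in the variable `s`, `z = 1 - 1/(u + c s)`. -/
theorem tail_eq_weighted {u c k : ℝ} (hu : 0 < u) (hc : 0 < c) {g X : ℝ → ℝ}
    (hg : ∀ s, 0 < s → g (1 - 1 / (u + c * s)) = k * X s) :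
    tail g (1 - 1 / u) = k * (c / u ^ 2) * weighted X (c / u) := by
  rw [tail, integral_eq_integral_Ioi hu hc, weighted, ← integral_const_mul]
  refine setIntegral_congr_fun measurableSet_Ioi fun s (hs : 0 < s) => ?_
  rw [hg s hs, show u + c * s = u * (1 + c / u * s) by field_simp]
  have : 0 < 1 + c / u * s := by positivity
  field_simp

/-! ### The stationary solution -/

theorem stationaryExp_eq {φ ψ : ℝ → ℝ} {κ A : ℝ} (h : ∀ x, κ * ψ x - φ x = A * (1 - x) ^ 2)
    {u : ℝ} (hu : 1 ≤ u) : stationaryExp φ ψ κ (1 - 1 / u) = Real.exp (-((u - 1) / A)) := by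
  have hI := one_sub_one_div_mem_Ico hu
  have hd : ∀ z ∈ uIcc 0 (1 - 1 / u), HasDerivAt (fun z : ℝ => 1 / A * (1 - z)⁻¹)
      (1 / (A * (1 - z) ^ 2)) z := by
    intro z hz
    rw [uIcc_of_le hI.1] at hz
    have hz1 : 1 - z ≠ 0 := by linarith [hz.2, hI.2]
    refine ((((hasDerivAt_id z).const_sub 1).inv hz1).const_mul (1 / A)).congr_deriv ?_
    simp only [id]
    rw [one_div, one_div, mul_inv, neg_neg, one_div]
  have hint : IntervalIntegrable (fun z : ℝ => 1 / (A * (1 - z) ^ 2)) volume 0 (1 - 1 / u) := by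
    by_cases hA : A = 0
    · simp [hA]
    refine ContinuousOn.intervalIntegrable (ContinuousOn.div (by fun_prop) (by fun_prop) ?_)
    intro z hz
    rw [uIcc_of_le hI.1] at hz
    have : 0 < 1 - z := by linarith [hz.2, hI.2]
    positivity
  rw [stationaryExp]
  simp only [h]
  rw [intervalIntegral.integral_eq_sub_of_hasDerivAt hd hint]
  congr 2
  simp
  ring

theorem beta_stationary {φ ψ : ℝ → ℝ} (hm : IsQuadraticModel φ ψ) {A : ℝ} (hA : 0 < A)
    (h : ∀ x, kappaZero φ ψ * ψ x - φ x = A * (1 - x) ^ 2) {u : ℝ} (hu : 1 ≤ u) :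
    beta (stationary φ ψ (kappaZero φ ψ)) (1 - 1 / u) =
      weighted (fun s => Real.exp (-s)) (A / u) := by
  have hu0 : 0 < u := by linarith
  have hI := one_sub_one_div_mem_Ico hu
  have hN := stationaryExp_mass_pos hm
  set N := ∫ z in (0 : ℝ)..1, stationaryExp φ ψ (kappaZero φ ψ) z with hNdef
  have hE := Real.exp_pos (-((u - 1) / A))
  have hval : stationary φ ψ (kappaZero φ ψ) (1 - 1 / u) = Real.exp (-((u - 1) / A)) / N := by
    rw [stationary, stationaryExp_eq h hu]
  have hdens : density (stationary φ ψ (kappaZero φ ψ)) (1 - 1 / u) =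
      Real.exp (-((u - 1) / A)) / N * (u ^ 2 / A) := by
    have hd : HasDerivAt (stationary φ ψ (kappaZero φ ψ)) _ (1 - 1 / u) :=
      (stationaryExp_hasDerivAt hA h hI).div_const N
    rw [density, hd.hasDerivWithinAt.derivWithin (uniqueDiffOn_Ico 0 1 _ hI),
      stationaryExp_eq h hu]
    field_simp
    ring
  have htail := tail_eq_weighted (g := stationary φ ψ (kappaZero φ ψ))
    (X := fun s => Real.exp (-s)) (k := Real.exp (-((u - 1) / A)) / N) hu0 hA (fun s hs => by
      have : 1 ≤ u + A * s := by have := mul_pos hA hs; linarith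
      rw [stationary, stationaryExp_eq h this, ← hNdef, div_mul_eq_mul_div, ← Real.exp_add]
      congr 2
      field_simp
      ring)
  rw [beta, hdens, htail, hval]
  field_simp

/-! ### The affine flow of the characteristics -/

theorem IsQuadraticModel.exists_coefficients {φ ψ : ℝ → ℝ} (hm : IsQuadraticModel φ ψ) :
    ∃ b m p : ℝ, 0 < b ∧ b < 1 ∧ 0 < m ∧ 0 ≤ p ∧ (∀ x, φ x = b * x * (1 - x)) ∧
      (∀ x, ψ x = (1 - x) * (m + p * (1 - x))) ∧ kappaZero φ ψ = b / m := by
  obtain ⟨a, b, c, hφ⟩ := hm.quadratic_φ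
  obtain ⟨p, q, r, hψ⟩ := hm.quadratic_ψ
  have hd : ∀ (f : ℝ → ℝ) (a b c : ℝ), (∀ x, f x = a * x ^ 2 + b * x + c) →
      deriv f 1 = 2 * a + b := by
    intro f a b c hf
    have h1 : HasDerivAt (fun x : ℝ => a * x ^ 2 + b * x + c) (a * (2 * 1) + b * 1) 1 := by
      simpa using ((((hasDerivAt_pow 2 (1 : ℝ)).const_mul a).add
        ((hasDerivAt_id (1 : ℝ)).const_mul b)).add_const c)
    rw [funext hf, h1.deriv]
    ring
  have dφ := hd φ a b c hφ
  have dψ := hd ψ p q r hψ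
  have h0 := hm.φ_zero
  have h1 := hm.φ_one
  have h2 := hm.ψ_one
  have h3 := hm.deriv_φ_neg
  have h4 := hm.deriv_ψ_neg
  have h5 := hm.deriv_φ_gt
  rw [hφ] at h0 h1
  rw [hψ] at h2
  rw [dφ] at h3 h5
  rw [dψ] at h4
  have hc : c = 0 := by linarith
  have hb : b = -a := by linarith
  have hp : 0 ≤ p := by
    have := hm.convex_ψ.2 (left_mem_Icc.2 (zero_le_one' ℝ)) (right_mem_Icc.2 (zero_le_one' ℝ))
      (by norm_num : (0 : ℝ) ≤ 1 / 2) (by norm_num : (0 : ℝ) ≤ 1 / 2) (by norm_num)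
    simp only [hψ, smul_eq_mul] at this
    linarith
  refine ⟨-a, -(2 * p + q), p, by linarith, by linarith, by linarith, hp, fun x => ?_, fun x => ?_,
    ?_⟩
  · rw [hφ, hc, hb]; ring
  · rw [hψ, show r = -p - q by linarith]; ring
  · rw [kappaZero, dφ, dψ, neg_div_neg_eq, hb]; ring

section Flow

variable {b m p : ℝ} {κ : ℝ → ℝ}

/-- The accumulated `∫₀ᵀ κ`. -/
noncomputable def cumulative (κ : ℝ → ℝ) (T : ℝ) : ℝ := ∫ s in (0 : ℝ)..T, κ s

/-- In the coordinate `u = 1 / (1 - x)` a characteristic for `φ x = b x (1 - x)`,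
`ψ x = (1 - x) (m + p (1 - x))` satisfies a linear equation, so that
`u(0) = dilation T * u(T) + shift T`. -/
noncomputable def dilation (b m : ℝ) (κ : ℝ → ℝ) (T : ℝ) : ℝ :=
  Real.exp (m * cumulative κ T - b * T)

/-- The constant term of the affine map `u(T) ↦ u(0)` along characteristics. -/
noncomputable def shift (b m p : ℝ) (κ : ℝ → ℝ) (T : ℝ) : ℝ :=
  ∫ s in (0 : ℝ)..T, dilation b m κ s * (b + κ s * p)

/-- The coordinate `u(0)` of the initial point of the characteristic through `x = 0` at time `T`. -/
noncomputable def front (b m p : ℝ) (κ : ℝ → ℝ) (T : ℝ) : ℝ :=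
  dilation b m κ T + shift b m p κ T

theorem cumulative_hasDerivAt (hκ : Continuous κ) (T : ℝ) :
    HasDerivAt (cumulative κ) (κ T) T :=
  intervalIntegral.integral_hasDerivAt_right (hκ.intervalIntegrable _ _)
    hκ.aestronglyMeasurable.stronglyMeasurableAtFilter hκ.continuousAt

theorem dilation_pos (T : ℝ) : 0 < dilation b m κ T := Real.exp_pos _

theorem dilation_hasDerivAt (hκ : Continuous κ) (T : ℝ) :
    HasDerivAt (dilation b m κ) (dilation b m κ T * (m * κ T - b)) T := by
  have := (((cumulative_hasDerivAt hκ T).const_mul m).sub ((hasDerivAt_id T).const_mul b)).exp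
  rw [mul_one] at this
  exact this

theorem shift_hasDerivAt (hκ : Continuous κ) (T : ℝ) :
    HasDerivAt (shift b m p κ) (dilation b m κ T * (b + κ T * p)) T := by
  have hd : Continuous (dilation b m κ) :=
    continuous_iff_continuousAt.2 fun s => (dilation_hasDerivAt hκ s).continuousAt
  have hc : Continuous fun s => dilation b m κ s * (b + κ s * p) := by fun_prop
  exact intervalIntegral.integral_hasDerivAt_right (hc.intervalIntegrable _ _)
    hc.aestronglyMeasurable.stronglyMeasurableAtFilter hc.continuousAt

theorem front_hasDerivAt (hκ : Continuous κ) (T : ℝ) :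
    HasDerivAt (front b m p κ) (dilation b m κ T * (κ T * (m + p))) T :=
  ((dilation_hasDerivAt hκ T).add (shift_hasDerivAt hκ T)).congr_deriv (by ring)

theorem shift_nonneg (hκ0 : ∀ s, 0 ≤ κ s) (hb : 0 ≤ b) (hp : 0 ≤ p) {T : ℝ} (hT : 0 ≤ T) :
    0 ≤ shift b m p κ T :=
  intervalIntegral.integral_nonneg hT fun s _ =>
    mul_nonneg (dilation_pos s).le (add_nonneg hb (mul_nonneg (hκ0 s) hp))

theorem cumulative_mono (hκ : Continuous κ) (hκ0 : ∀ s, 0 ≤ κ s) : Monotone (cumulative κ) :=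
  monotone_of_hasDerivAt_nonneg (cumulative_hasDerivAt hκ) hκ0

theorem front_mono (hκ : Continuous κ) (hκ0 : ∀ s, 0 ≤ κ s) (hm : 0 < m) (hp : 0 ≤ p) :
    Monotone (front b m p κ) :=
  monotone_of_hasDerivAt_nonneg (front_hasDerivAt hκ) fun T =>
    mul_nonneg (dilation_pos T).le (mul_nonneg (hκ0 T) (by linarith))

theorem one_le_front (hκ : Continuous κ) (hκ0 : ∀ s, 0 ≤ κ s) (hm : 0 < m) (hp : 0 ≤ p) {T : ℝ}
    (hT : 0 ≤ T) : 1 ≤ front b m p κ T := by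
  have := front_mono (b := b) hκ hκ0 hm hp hT
  simpa [front, dilation, shift, cumulative] using this

theorem one_le_dilation_mul_add_shift (hκ : Continuous κ) (hκ0 : ∀ s, 0 ≤ κ s) (hm : 0 < m)
    (hp : 0 ≤ p) {T u : ℝ} (hT : 0 ≤ T) (hu : 1 ≤ u) :
    1 ≤ dilation b m κ T * u + shift b m p κ T := by
  have h1 := one_le_front (b := b) hκ hκ0 hm hp hT
  have h2 := mul_le_mul_of_nonneg_left hu (dilation_pos (b := b) (m := m) (κ := κ) T).le
  rw [front] at h1
  linarith

/-- Along a characteristic, `u = 1 / (1 - y)` solves `u' = (b - κ m) u - (b + κ p)`. -/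
theorem IsCharacteristic.affine {φ ψ y : ℝ → ℝ} {T : ℝ} (hκ : Continuous κ)
    (hφ : ∀ x, φ x = b * x * (1 - x)) (hψ : ∀ x, ψ x = (1 - x) * (m + p * (1 - x)))
    (hT : 0 ≤ T) (hy : IsCharacteristic φ ψ κ T y) :
    1 / (1 - y 0) = dilation b m κ T * (1 / (1 - y T)) + shift b m p κ T := by
  have hderiv : ∀ s ∈ Icc 0 T, HasDerivWithinAt
      (fun s => dilation b m κ s * (1 / (1 - y s)) + shift b m p κ s) 0 (Icc 0 T) s := by
    intro s hs
    obtain ⟨hmem, hd⟩ := hy s hs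
    have h1 : 1 - y s ≠ 0 := by linarith [hmem.2]
    have h2 := (((dilation_hasDerivAt (b := b) (m := m) hκ s).hasDerivWithinAt (s := Icc 0 T)).mul
      ((hd.const_sub 1).inv h1)).add
        (shift_hasDerivAt (b := b) (m := m) (p := p) hκ s).hasDerivWithinAt
    simp only [one_div]
    refine h2.congr_deriv ?_
    rw [hφ, hψ]
    simp only [Pi.inv_apply]
    field_simp
    ring
  have := constant_of_derivWithin_zero (fun s hs => (hderiv s hs).differentiableWithinAt)
    (fun s hs => (hderiv s (Ico_subset_Icc_self hs)).derivWithin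
      (uniqueDiffOn_Icc (hs.1.trans_lt hs.2) s (Ico_subset_Icc_self hs))) T ⟨hT, le_rfl⟩
  simp only [shift, dilation, cumulative, intervalIntegral.integral_same, mul_zero, sub_zero,
    Real.exp_zero, one_mul, add_zero] at this
  exact this.symm

end Flow

/-! ### Solutions -/

theorem IsSolution.congr {φ ψ κ κ' : ℝ → ℝ} {w : ℝ → ℝ → ℝ} (hw : IsSolution φ ψ w κ)
    (h : ∀ s, 0 ≤ s → κ' s = κ s) : IsSolution φ ψ w κ' where
  continuous_κ := hw.continuous_κ.congr fun s hs => h s hs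
  transport T hT x hx := by
    obtain ⟨y, h1, h2, h3⟩ := hw.transport T hT x hx
    refine ⟨y, fun s hs => ⟨(h1 s hs).1, ?_⟩, h2, h3⟩
    rw [h s hs.1]
    exact (h1 s hs).2
  mass := hw.mass

/-- A characteristic through `(0, T)` stays in `[0,1)` on `[0,T]`, so its derivative at time `T`,
which is `-κ(T) ψ(0)`, cannot be positive. -/
theorem IsSolution.kappa_nonneg {φ ψ κ : ℝ → ℝ} {w : ℝ → ℝ → ℝ} (hw : IsSolution φ ψ w κ)
    (hφ : φ 0 = 0) (hψ : 0 < ψ 0) {T : ℝ} (hT : 0 ≤ T) : 0 ≤ κ T := by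
  have hpos : ∀ T, 0 < T → 0 ≤ κ T := by
    intro T hT
    obtain ⟨y, h1, h2, -⟩ := hw.transport T hT.le 0 ⟨le_rfl, one_pos⟩
    have hd := (h1 T ⟨hT.le, le_rfl⟩).2
    rw [h2, hφ, hasDerivWithinAt_iff_tendsto_slope, Icc_sdiff_right,
      nhdsWithin_Ico_eq_nhdsLT hT] at hd
    have hle : 0 - κ T * ψ 0 ≤ 0 := by
      refine le_of_tendsto hd ?_
      filter_upwards [Ioo_mem_nhdsLT hT] with s hs
      rw [slope_def_field, h2, sub_zero]
      exact div_nonpos_of_nonneg_of_nonpos (h1 s ⟨hs.1.le, hs.2.le⟩).1.1 (by linarith [hs.2])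
    exact nonneg_of_mul_nonneg_left (by linarith) hψ
  rcases hT.eq_or_lt with rfl | hT
  · have h := (hw.continuous_κ 0 self_mem_Ici).mono Ioi_subset_Ici_self
    exact ge_of_tendsto h.tendsto (eventually_mem_nhdsWithin.mono fun s hs => hpos s hs)
  · exact hpos T hT

theorem IsSolution.eq_exp_mul_profile {φ ψ κ : ℝ → ℝ} {w : ℝ → ℝ → ℝ} {b m p : ℝ}
    (hw : IsSolution φ ψ w κ) (hκ : Continuous κ)
    (hφ : ∀ x, φ x = b * x * (1 - x)) (hψ : ∀ x, ψ x = (1 - x) * (m + p * (1 - x)))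
    {T : ℝ} (hT : 0 ≤ T) {u : ℝ} (hu : 1 ≤ u) :
    w (1 - 1 / u) T =
      Real.exp T * profile (fun x => w x 0) (dilation b m κ T * u + shift b m p κ T) := by
  obtain ⟨y, h1, h2, h3⟩ := hw.transport T hT (1 - 1 / u) (one_sub_one_div_mem_Ico hu)
  have haff := h1.affine hκ hφ hψ hT
  rw [h2, sub_sub_cancel, one_div_one_div] at haff
  have hderiv : ∀ s ∈ Icc 0 T, HasDerivWithinAt
      (fun s => Real.exp (-s) * w (y s) s) 0 (Icc 0 T) s := by
    intro s hs
    exact ((hasDerivAt_neg s).exp.hasDerivWithinAt.mul (h3 s hs)).congr_deriv (by ring)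
  have := constant_of_derivWithin_zero (fun s hs => (hderiv s hs).differentiableWithinAt)
    (fun s hs => (hderiv s (Ico_subset_Icc_self hs)).derivWithin
      (uniqueDiffOn_Icc (hs.1.trans_lt hs.2) s (Ico_subset_Icc_self hs))) T ⟨hT, le_rfl⟩
  simp only [neg_zero, Real.exp_zero, one_mul, h2] at this
  rw [profile, ← haff, one_div_one_div, sub_sub_cancel, ← this, ← mul_assoc, ← Real.exp_add]
  simp

/-! ### A barrier argument -/

/-- If above the level `a` the function `G` grows at least at the rate of the unbounded clock `M`
and remains bounded, and if `G` is smaller at the level `b > a` than at the level `a`, then `Q`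
eventually remains below `b`: it has to come below `a`, and on an excursion from `a` to `b`
the function `G` would both grow and drop. -/
theorem eventually_lt_of_barrier {Q G M : ℝ → ℝ} {T₀ a b c C : ℝ} (hab : a < b) (hc : 0 < c)
    (hQ : ContinuousOn Q (Ici T₀)) (hM : Tendsto M atTop atTop) (hMmono : Monotone M)
    (hgrow : ∀ T₁ T₂, T₀ ≤ T₁ → T₁ ≤ T₂ → (∀ t ∈ Icc T₁ T₂, a ≤ Q t) →
      c * (M T₂ - M T₁) ≤ G T₂ - G T₁)
    (hbdd : ∀ t, T₀ ≤ t → a ≤ Q t → G t ≤ C)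
    (hcmp : ∀ T₁ T₂, T₀ ≤ T₁ → T₀ ≤ T₂ → Q T₁ = a → Q T₂ = b → G T₂ < G T₁) :
    ∀ᶠ t in atTop, Q t < b := by
  obtain ⟨T, hT, hQT⟩ : ∃ T, T₀ ≤ T ∧ Q T < a := by
    by_contra! h
    obtain ⟨t, ht, hMt⟩ := ((eventually_ge_atTop T₀).and
      (hM.eventually_gt_atTop ((C - G T₀) / c + M T₀))).exists
    have h1 := hgrow T₀ t le_rfl ht fun s hs => h s hs.1
    have h2 := hbdd t ht (h t ht)
    have h3 : (C - G T₀) / c < M t - M T₀ := by linarith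
    rw [div_lt_iff₀ hc] at h3
    linarith
  filter_upwards [eventually_ge_atTop T] with t ht
  by_contra! hbt
  have hcont : ∀ {x}, T ≤ x → ContinuousOn Q (Icc x t) := fun hx =>
    hQ.mono fun s hs => hT.trans (hx.trans hs.1)
  have hcompact : IsCompact (Icc T t ∩ Q ⁻¹' Iic a) :=
    isCompact_Icc.of_isClosed_subset
      ((hcont le_rfl).preimage_isClosed_of_isClosed isClosed_Icc isClosed_Iic) inter_subset_left
  obtain ⟨T₁, ⟨hT₁, hQT₁⟩, hmax⟩ := hcompact.exists_isGreatest ⟨T, ⟨le_rfl, ht⟩, hQT.le⟩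
  have hQT₁ : Q T₁ ≤ a := hQT₁
  have hgt : ∀ s, T₁ < s → s ≤ t → a < Q s := by
    intro s hs hst
    by_contra! h
    exact absurd (hmax ⟨⟨hT₁.1.trans hs.le, hst⟩, h⟩) (not_le.2 hs)
  have hQa : Q T₁ = a := by
    refine hQT₁.antisymm (not_lt.1 fun hlt => ?_)
    obtain ⟨s, hs, hQs⟩ := intermediate_value_Icc hT₁.2 (hcont hT₁.1) ⟨hlt.le, hab.le.trans hbt⟩
    rcases hs.1.eq_or_lt with rfl | h
    · exact hlt.ne hQs
    · exact (hgt s h hs.2).ne' hQs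
  obtain ⟨T₂, hT₂, hQb⟩ := intermediate_value_Icc hT₁.2 (hcont hT₁.1)
    (show b ∈ Icc (Q T₁) (Q t) from ⟨hQa.le.trans hab.le, hbt⟩)
  have hT₁0 := hT.trans hT₁.1
  have h1 := hgrow T₁ T₂ hT₁0 hT₂.1 fun s hs => by
    rcases hs.1.eq_or_lt with rfl | h
    · exact hQa.ge
    · exact (hgt s h (hs.2.trans hT₂.2)).le
  have h2 := hcmp T₁ T₂ hT₁0 (hT₁0.trans hT₂.1) hQa hQb
  have h3 := mul_nonneg hc.le (sub_nonneg.2 (hMmono hT₂.1))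
  linarith

/-! ### Dynamics of the front -/

/-- A solution with critical initial datum `f`, written in the coordinate `u = 1 / (1 - x)`, for
the model `φ x = b x (1 - x)`, `ψ x = (1 - x) (m + p (1 - x))`. The function `κ` is extended
to a continuous nonnegative function on `ℝ`. -/
structure IsCriticalFlow (f : ℝ → ℝ) (w : ℝ → ℝ → ℝ) (b m p : ℝ) (κ : ℝ → ℝ) : Prop where
  b_pos : 0 < b
  b_lt_one : b < 1
  m_pos : 0 < m
  p_nonneg : 0 ≤ p
  continuous_κ : Continuous κ
  κ_nonneg : ∀ s, 0 ≤ κ s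
  datum : IsInitialDatum f
  critical : Tendsto (beta f) (𝓝[betaDomain f] 1) (𝓝 1)
  eq_exp : ∀ T, 0 ≤ T → ∀ u, 1 ≤ u →
    w (1 - 1 / u) T = Real.exp T * profile f (dilation b m κ T * u + shift b m p κ T)
  mass : ∀ T, 0 ≤ T → ∫ x in (0 : ℝ)..1, w x T = 1

/-- The length scale of the datum at the front, in units of `dilation`; it converges to the length
scale of the stationary solution. -/
noncomputable def frontScale (f : ℝ → ℝ) (b m p : ℝ) (κ : ℝ → ℝ) (T : ℝ) : ℝ :=
  scale f (front b m p κ T) / dilation b m κ T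

/-- The energy of the datum at the front; `1 + 1 / b > 2`. -/
noncomputable def frontEnergy (f : ℝ → ℝ) (b m p : ℝ) (κ : ℝ → ℝ) (T : ℝ) : ℝ :=
  energy (1 + 1 / b) (rescaled f (front b m p κ T)) (frontScale f b m p κ T)

theorem IsInitialDatum.continuousOn_scale {f : ℝ → ℝ} (hf : IsInitialDatum f) :
    ContinuousOn (scale f) (Ioi 1) := by
  intro v (hv : 1 < v)
  have h1 : ContinuousAt (fun v => tail f (1 - 1 / v)) v :=
    ContinuousAt.comp (g := tail f) (f := fun v : ℝ => 1 - 1 / v)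
      (hf.tail_hasDerivAt (one_sub_one_div_mem_Ioo hv)).continuousAt
      (hasDerivAt_one_sub_one_div (by linarith)).continuousAt
  have h2 : ContinuousAt (profile f) v := hf.continuousOn_profile.continuousAt (Ici_mem_nhds hv)
  exact (((continuousAt_id.pow 2).mul h1).div h2 (hf.profile_pos hv.le).ne').continuousWithinAt

namespace IsCriticalFlow

variable {f : ℝ → ℝ} {w : ℝ → ℝ → ℝ} {b m p : ℝ} {κ : ℝ → ℝ}

theorem eq_exp' (H : IsCriticalFlow f w b m p κ) {T : ℝ} (hT : 0 ≤ T) {x : ℝ}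
    (hx : x ∈ Ico (0 : ℝ) 1) : w x T =
      Real.exp T * profile f (dilation b m κ T * (1 / (1 - x)) + shift b m p κ T) := by
  have h1 : 0 < 1 - x := by linarith [hx.2]
  have := H.eq_exp T hT (1 / (1 - x)) ((one_le_div h1).2 (by linarith [hx.1]))
  rwa [one_div_one_div, sub_sub_cancel] at this

theorem one_le_arg (H : IsCriticalFlow f w b m p κ) {T u : ℝ} (hT : 0 ≤ T) (hu : 1 ≤ u) :
    1 ≤ dilation b m κ T * u + shift b m p κ T :=
  one_le_dilation_mul_add_shift H.continuous_κ H.κ_nonneg H.m_pos H.p_nonneg hT hu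

theorem front_mono (H : IsCriticalFlow f w b m p κ) : Monotone (front b m p κ) :=
  LSW.front_mono H.continuous_κ H.κ_nonneg H.m_pos H.p_nonneg

theorem cumulative_mono (H : IsCriticalFlow f w b m p κ) : Monotone (cumulative κ) :=
  LSW.cumulative_mono H.continuous_κ H.κ_nonneg

/-- If the front stayed bounded, then `w` would be bounded below by a multiple of `exp T` on
`[0, 1/2]`, which contradicts conservation of mass. -/
theorem tendsto_front (H : IsCriticalFlow f w b m p κ) :
    Tendsto (front b m p κ) atTop atTop := by
  refine H.front_mono.tendsto_atTop_atTop fun M => ?_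
  by_contra! hM
  have hM1 : 1 < M := (one_le_front H.continuous_κ H.κ_nonneg H.m_pos H.p_nonneg le_rfl).trans_lt
    (hM 0)
  have hW := H.datum.profile_pos (v := 2 * M) (by linarith)
  obtain ⟨T, hT, hT0⟩ := ((Real.tendsto_exp_atTop.eventually_gt_atTop
    (2 / profile f (2 * M))).and (eventually_ge_atTop 0)).exists
  rw [div_lt_iff₀ hW] at hT
  have hpos : ∀ x ∈ Ico (0 : ℝ) 1, 0 ≤ w x T := fun x hx => by
    rw [H.eq_exp' hT0 hx]
    have h1 : 0 < 1 - x := by linarith [hx.2]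
    exact (mul_pos (Real.exp_pos T) (H.datum.profile_pos (H.one_le_arg hT0
      ((one_le_div h1).2 (by linarith [hx.1]))))).le
  have hint : IntervalIntegrable (fun x => w x T) volume 0 1 := by
    by_contra h
    have := H.mass T hT0
    rw [intervalIntegral.integral_undef h] at this
    exact zero_ne_one this
  have h1 : ∫ x in (0 : ℝ)..(1 / 2), w x T ≤ ∫ x in (0 : ℝ)..1, w x T := by
    refine intervalIntegral.integral_mono_interval le_rfl (by norm_num) (by norm_num) ?_ hint
    rw [← restrict_Ioo_eq_restrict_Ioc]
    exact (ae_restrict_mem measurableSet_Ioo).mono fun x hx => hpos x ⟨hx.1.le, hx.2⟩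
  have h2 : ∫ _x in (0 : ℝ)..(1 / 2), Real.exp T * profile f (2 * M) ≤
      ∫ x in (0 : ℝ)..(1 / 2), w x T := by
    refine intervalIntegral.integral_mono_on (by norm_num) intervalIntegrable_const
      (hint.mono_set ?_) fun x hx => ?_
    · rw [uIcc_of_le (by norm_num), uIcc_of_le (by norm_num)]
      exact Icc_subset_Icc_right (by norm_num)
    · have hx1 : 0 < 1 - x := by linarith [hx.2]
      have hu1 : 1 ≤ 1 / (1 - x) := (one_le_div hx1).2 (by linarith [hx.1])
      have hu2 : 1 / (1 - x) ≤ 2 := by rw [div_le_iff₀ hx1]; linarith [hx.2]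
      rw [H.eq_exp' hT0 ⟨hx.1, by linarith [hx.2]⟩]
      refine mul_le_mul_of_nonneg_left ?_ (Real.exp_pos T).le
      refine H.datum.profile_antitone (H.one_le_arg hT0 hu1) ?_
      have h3 := hM T
      rw [front] at h3
      have h4 := shift_nonneg (b := b) (m := m) (p := p) H.κ_nonneg H.b_pos.le H.p_nonneg hT0
      have h5 := mul_le_mul_of_nonneg_left hu2 (dilation_pos (b := b) (m := m) (κ := κ) T).le
      linarith
  rw [intervalIntegral.integral_const, smul_eq_mul] at h2
  have := H.mass T hT0
  linarith

/-- If `∫₀^∞ κ` were finite, then `dilation`, and hence the front, would be bounded. -/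
theorem tendsto_cumulative (H : IsCriticalFlow f w b m p κ) :
    Tendsto (cumulative κ) atTop atTop := by
  refine H.cumulative_mono.tendsto_atTop_atTop fun C => ?_
  by_contra! hC
  have hm := H.m_pos
  have hp := H.p_nonneg
  obtain ⟨T, hT, hT0⟩ := ((H.tendsto_front.eventually_gt_atTop
    (front b m p κ 0 + (m + p) * Real.exp (m * C) * C)).and (eventually_ge_atTop 0)).exists
  have h1 := le_of_hasDerivAt_nonpos
    (f := fun t => front b m p κ t - (m + p) * Real.exp (m * C) * cumulative κ t)
    (f' := fun t => dilation b m κ t * (κ t * (m + p)) - (m + p) * Real.exp (m * C) * κ t) hT0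
    (fun t _ => (front_hasDerivAt H.continuous_κ t).sub
      ((cumulative_hasDerivAt H.continuous_κ t).const_mul _))
    (fun t ht => by
      have h2 : dilation b m κ t ≤ Real.exp (m * C) := by
        refine Real.exp_le_exp.2 ?_
        have h3 := mul_le_mul_of_nonneg_left (hC t).le hm.le
        have h4 := mul_nonneg H.b_pos.le ht.1
        linarith
      have h3 := mul_le_mul_of_nonneg_right h2
        (mul_nonneg (H.κ_nonneg t) (by linarith : 0 ≤ m + p))
      linarith)
  have h2 : cumulative κ 0 = 0 := by simp [cumulative]
  have h3 : (m + p) * Real.exp (m * C) * cumulative κ T ≤ (m + p) * Real.exp (m * C) * C :=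
    mul_le_mul_of_nonneg_left (hC T).le (by positivity)
  simp only [h2] at h1
  linarith

/-- The tail of `w(·,T)` at `x`, through the rescaled datum at the point `v` which the
characteristic through `(x, T)` starts from. -/
theorem tail_eq (H : IsCriticalFlow f w b m p κ) {T u v : ℝ} (hT : 0 ≤ T) (hu : 1 ≤ u)
    (hv : v = dilation b m κ T * u + shift b m p κ T) :
    tail (fun x => w x T) (1 - 1 / u) =
      Real.exp T * profile f v * (scale f v / dilation b m κ T / u ^ 2) *
        weighted (rescaled f v) (scale f v / dilation b m κ T / u) := by
  have hv1 : 1 ≤ v := hv ▸ H.one_le_arg hT hu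
  have hd := dilation_pos (b := b) (m := m) (κ := κ) T
  have hρ := H.datum.scale_pos hv1
  refine tail_eq_weighted (by linarith) (div_pos hρ hd) fun s hs => ?_
  have h1 : 1 ≤ u + scale f v / dilation b m κ T * s := by
    have : 0 < scale f v / dilation b m κ T * s := by positivity
    linarith
  have h2 : dilation b m κ T * (u + scale f v / dilation b m κ T * s) + shift b m p κ T =
      v + scale f v * s := by
    rw [hv]
    field_simp
    ring
  have h3 := H.datum.profile_pos hv1
  rw [H.eq_exp T hT _ h1, h2, rescaled]
  field_simp

theorem frontScale_pos (H : IsCriticalFlow f w b m p κ) {T : ℝ} (hT : 0 ≤ T) :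
    0 < frontScale f b m p κ T :=
  div_pos (H.datum.scale_pos (one_le_front H.continuous_κ H.κ_nonneg H.m_pos H.p_nonneg hT))
    (dilation_pos T)

/-- Conservation of mass expresses the energy at the front through explicit quantities. -/
theorem frontEnergy_eq (H : IsCriticalFlow f w b m p κ) {T : ℝ} (hT : 0 ≤ T)
    (hint : IntegrableOn (rescaled f (front b m p κ T)) (Ioi 0)) :
    frontEnergy f b m p κ T = T + Real.log (profile f (front b m p κ T)) -
      1 / b * Real.log (scale f (front b m p κ T)) + 1 / b * (m * cumulative κ T - b * T) := by
  have hv1 := one_le_front (b := b) H.continuous_κ H.κ_nonneg H.m_pos H.p_nonneg hT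
  have h1 := H.tail_eq (v := front b m p κ T) hT le_rfl (by rw [front, mul_one])
  rw [tail, div_one, sub_self, H.mass T hT, one_pow, div_one] at h1
  have h2 := H.datum.profile_pos hv1
  have h3 := H.frontScale_pos hT
  have h4 := weighted_pos hint (fun s hs => H.datum.rescaled_pos hv1 hs.le) h3.le
  have h5 := congrArg Real.log h1
  rw [frontScale] at h3 h4
  rw [Real.log_mul (by positivity) h4.ne', Real.log_mul (by positivity) h3.ne',
    Real.log_mul (Real.exp_pos T).ne' h2.ne', Real.log_exp, Real.log_one] at h5
  have h6 : Real.log (scale f (front b m p κ T) / dilation b m κ T) =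
      Real.log (scale f (front b m p κ T)) - (m * cumulative κ T - b * T) := by
    rw [Real.log_div (H.datum.scale_pos hv1).ne' (dilation_pos T).ne', dilation, Real.log_exp]
  rw [frontEnergy, energy, frontScale]
  rw [h6] at h5 ⊢
  linarith

/-- The increments of the energy at the front. -/
theorem eventually_frontEnergy_sub (H : IsCriticalFlow f w b m p κ) {ε : ℝ} (hε : 0 < ε) :
    ∀ᶠ T₀ in atTop, ∀ T₁ T₂, T₀ ≤ T₁ → T₁ ≤ T₂ →
      |frontEnergy f b m p κ T₂ - frontEnergy f b m p κ T₁ -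
        (m / b * (cumulative κ T₂ - cumulative κ T₁) -
          (potential f (front b m p κ T₂) - potential f (front b m p κ T₁)))| ≤
        ε * (potential f (front b m p κ T₂) - potential f (front b m p κ T₁)) := by
  have hb := H.b_pos
  have hε' : 0 < ε / (1 + 1 / b) := by positivity
  obtain ⟨T, hT⟩ := (H.tendsto_front.eventually
    (H.datum.eventually_integrableOn_rescaled H.critical)).exists_forall_of_atTop
  filter_upwards [H.tendsto_front.eventually (H.datum.eventually_slowly_varying H.critical hε'),
    eventually_ge_atTop 0, eventually_ge_atTop T] with T₀ hS hT₀ hTT₀ T₁ T₂ h1 h2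
  rw [H.frontEnergy_eq (hT₀.trans h1) (hT T₁ (hTT₀.trans h1)).2,
    H.frontEnergy_eq (hT₀.trans (h1.trans h2)) (hT T₂ (hTT₀.trans (h1.trans h2))).2]
  obtain ⟨a1, a2, -⟩ := hS.2 _ _ (H.front_mono h1) (H.front_mono h2)
  set D := potential f (front b m p κ T₂) - potential f (front b m p κ T₁) with hD
  have e : ε * D = ε / (1 + 1 / b) * D + 1 / b * (ε / (1 + 1 / b) * D) := by field_simp
  rw [e]
  set W₁ := Real.log (profile f (front b m p κ T₁))
  set W₂ := Real.log (profile f (front b m p κ T₂))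
  set S₁ := Real.log (scale f (front b m p κ T₁))
  set S₂ := Real.log (scale f (front b m p κ T₂))
  have e2 : T₂ + W₂ - 1 / b * S₂ + 1 / b * (m * cumulative κ T₂ - b * T₂) -
      (T₁ + W₁ - 1 / b * S₁ + 1 / b * (m * cumulative κ T₁ - b * T₁)) -
      (m / b * (cumulative κ T₂ - cumulative κ T₁) - D) =
      -(W₁ - W₂ - D) + -(1 / b * (S₂ - S₁)) := by
    field_simp
    ring
  rw [e2]
  refine (abs_add_le _ _).trans ?_
  rw [abs_neg, abs_neg, abs_mul, abs_of_pos (one_div_pos.2 hb)]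
  have := mul_le_mul_of_nonneg_left a2 (one_div_pos.2 hb).le
  linarith

theorem potential_front_hasDerivAt (H : IsCriticalFlow f w b m p κ) {T : ℝ}
    (hT : 1 < front b m p κ T) :
    HasDerivAt (fun T => potential f (front b m p κ T))
      ((m + p) * κ T / frontScale f b m p κ T) T := by
  refine ((H.datum.potential_hasDerivAt hT).comp T
    (front_hasDerivAt H.continuous_κ T)).congr_deriv ?_
  have h1 := dilation_pos (b := b) (m := m) (κ := κ) T
  have h2 := H.datum.scale_pos hT.le
  rw [frontScale]
  field_simp

theorem potential_front_sub_le (H : IsCriticalFlow f w b m p κ) {T₁ T₂ a : ℝ} (ha : 0 < a)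
    (hT : 1 < front b m p κ T₁) (h12 : T₁ ≤ T₂)
    (hq : ∀ t ∈ Icc T₁ T₂, a ≤ frontScale f b m p κ t) :
    potential f (front b m p κ T₂) - potential f (front b m p κ T₁) ≤
      (m + p) / a * (cumulative κ T₂ - cumulative κ T₁) := by
  have := le_of_hasDerivAt_nonpos
    (f := fun t => potential f (front b m p κ t) - (m + p) / a * cumulative κ t)
    (f' := fun t => (m + p) * κ t / frontScale f b m p κ t - (m + p) / a * κ t) h12
    (fun t ht => (H.potential_front_hasDerivAt (hT.trans_le (H.front_mono ht.1))).sub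
      ((cumulative_hasDerivAt H.continuous_κ t).const_mul _))
    (fun t ht => by
      have h1 : 0 ≤ (m + p) * κ t :=
        mul_nonneg (by linarith [H.m_pos, H.p_nonneg]) (H.κ_nonneg t)
      rw [sub_nonpos, div_mul_eq_mul_div]
      exact div_le_div_of_nonneg_left h1 ha (hq t ht))
  linarith

theorem le_potential_front_sub (H : IsCriticalFlow f w b m p κ) {T₁ T₂ a : ℝ} (hT₁ : 0 ≤ T₁)
    (hT : 1 < front b m p κ T₁) (h12 : T₁ ≤ T₂)
    (hq : ∀ t ∈ Icc T₁ T₂, frontScale f b m p κ t ≤ a) :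
    (m + p) / a * (cumulative κ T₂ - cumulative κ T₁) ≤
      potential f (front b m p κ T₂) - potential f (front b m p κ T₁) := by
  have := le_of_hasDerivAt_nonneg
    (f := fun t => potential f (front b m p κ t) - (m + p) / a * cumulative κ t)
    (f' := fun t => (m + p) * κ t / frontScale f b m p κ t - (m + p) / a * κ t) h12
    (fun t ht => (H.potential_front_hasDerivAt (hT.trans_le (H.front_mono ht.1))).sub
      ((cumulative_hasDerivAt H.continuous_κ t).const_mul _))
    (fun t ht => by
      have h1 : 0 ≤ (m + p) * κ t :=
        mul_nonneg (by linarith [H.m_pos, H.p_nonneg]) (H.κ_nonneg t)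
      rw [sub_nonneg, div_mul_eq_mul_div]
      exact div_le_div_of_nonneg_left h1 (H.frontScale_pos (hT₁.trans ht.1)) (hq t ht))
  linarith

theorem continuousOn_frontScale (H : IsCriticalFlow f w b m p κ) {T₀ : ℝ}
    (hT₀ : 1 < front b m p κ T₀) : ContinuousOn (frontScale f b m p κ) (Ici T₀) := by
  intro T hT
  have h1 : 1 < front b m p κ T := hT₀.trans_le (H.front_mono hT)
  have h2 : ContinuousAt (fun T => scale f (front b m p κ T)) T :=
    ContinuousAt.comp (f := front b m p κ)
      (H.datum.continuousOn_scale.continuousAt (Ioi_mem_nhds h1))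
      (front_hasDerivAt H.continuous_κ T).continuousAt
  exact (h2.div (dilation_hasDerivAt H.continuous_κ T).continuousAt
    (dilation_pos T).ne').continuousWithinAt

/-- This is the assumption `-1 < φ'(1)`. -/
theorem two_lt (H : IsCriticalFlow f w b m p κ) : 2 < 1 + 1 / b := by
  have := (one_lt_div H.b_pos).2 H.b_lt_one
  linarith

/-- Monotonicity in `q` and the limit of the energy, along the front. -/
theorem eventually_energy (H : IsCriticalFlow f w b m p κ) {a c c' : ℝ} (ha : 0 < a)
    (hc : c < energy (1 + 1 / b) (fun s => Real.exp (-s)) a)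
    (hc' : energy (1 + 1 / b) (fun s => Real.exp (-s)) a < c') :
    ∀ᶠ T in atTop,
      (a ≤ frontScale f b m p κ T → frontEnergy f b m p κ T < c') ∧
      (frontScale f b m p κ T ≤ a → c < frontEnergy f b m p κ T) := by
  have h := (H.datum.tendsto_energy_rescaled H.critical (1 + 1 / b) ha).comp H.tendsto_front
  filter_upwards [h.eventually (lt_mem_nhds hc), h.eventually (gt_mem_nhds hc'),
    H.tendsto_front.eventually (H.datum.eventually_integrableOn_rescaled H.critical),
    eventually_ge_atTop 0] with T h1 h2 h3 h4
  have hpos : ∀ s, 0 < s → 0 < rescaled f (front b m p κ T) s := fun s hs =>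
    H.datum.rescaled_pos h3.1.le hs.le
  exact ⟨fun haq => (energy_anti h3.2 hpos H.two_lt ha haq).trans_lt h2,
    fun haq => h1.trans_le (energy_anti h3.2 hpos H.two_lt (H.frontScale_pos h4) haq)⟩

/-- While `frontScale > A`, the potential at the front grows slower than `(m / b) ∫ κ`, hence the
energy increases. -/
theorem eventually_frontScale_lt (H : IsCriticalFlow f w b m p κ) {a : ℝ}
    (ha : b * (m + p) / m < a) : ∀ᶠ T in atTop, frontScale f b m p κ T < a := by
  have hb := H.b_pos
  have hm := H.m_pos
  have hp := H.p_nonneg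
  obtain ⟨a₁, ha₁, ha₁a⟩ := exists_between ha
  have hA : 0 < b * (m + p) / m := by positivity
  have ha₁0 : 0 < a₁ := hA.trans ha₁
  obtain ⟨d, hd1, hd2⟩ := exists_between (energy_exp_lt H.two_lt ha₁0 ha₁a)
  -- chosen so that the growth rate `m / b - (1 + ε) (m + p) / a₁` is half of `m / b - (m + p) / a₁`
  set ε := (a₁ * m / (b * (m + p)) - 1) / 2 with hεdef
  have hε1 : b * (m + p) < a₁ * m := by rwa [div_lt_iff₀ hm] at ha₁
  have hε : 0 < ε := by
    have : 1 < a₁ * m / (b * (m + p)) := (one_lt_div (by positivity)).2 hε1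
    linarith
  obtain ⟨T₀, hT₀⟩ := ((H.eventually_frontEnergy_sub hε).and
    ((H.tendsto_front.eventually_gt_atTop 1).and
    ((H.eventually_energy ha₁0 hd2 (lt_add_one _)).and
      ((H.eventually_energy (ha₁0.trans ha₁a) (sub_one_lt _) hd1).and
        (eventually_ge_atTop 0))))).exists_forall_of_atTop
  have hrate : (1 + ε) * ((m + p) / a₁) = (m / b + (m + p) / a₁) / 2 := by
    rw [hεdef]
    field_simp
    ring
  have hrate' : 0 < (m / b - (m + p) / a₁) / 2 := by
    have : (m + p) / a₁ < m / b := by rw [div_lt_div_iff₀ ha₁0 hb]; linarith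
    linarith
  refine eventually_lt_of_barrier (G := frontEnergy f b m p κ) ha₁a hrate'
    (H.continuousOn_frontScale (hT₀ T₀ le_rfl).2.1) H.tendsto_cumulative H.cumulative_mono
    (fun T₁ T₂ h1 h2 hq => ?_) (fun t ht hq => ((hT₀ t ht).2.2.1.1 hq).le)
    (fun T₁ T₂ h1 h2 hq1 hq2 =>
      ((hT₀ T₂ h2).2.2.2.1.1 hq2.ge).trans ((hT₀ T₁ h1).2.2.1.2 hq1.le))
  have h3 := abs_le.1 ((hT₀ T₀ le_rfl).1 T₁ T₂ h1 h2)
  have h4 := H.potential_front_sub_le ha₁0 (hT₀ T₁ h1).2.1 h2 hq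
  have h5 := mul_le_mul_of_nonneg_left h4 (by linarith : 0 ≤ 1 + ε)
  rw [← mul_assoc, hrate] at h5
  linarith [h3.1]

/-- While `frontScale < A`, the potential at the front grows faster than `(m / b) ∫ κ`, hence the
energy decreases. -/
theorem eventually_lt_frontScale (H : IsCriticalFlow f w b m p κ) {a : ℝ} (ha0 : 0 < a)
    (ha : a < b * (m + p) / m) : ∀ᶠ T in atTop, a < frontScale f b m p κ T := by
  have hb := H.b_pos
  have hm := H.m_pos
  have hp := H.p_nonneg
  obtain ⟨a₁, ha₁a, ha₁⟩ := exists_between ha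
  have ha₁0 : 0 < a₁ := ha0.trans ha₁a
  obtain ⟨d, hd1, hd2⟩ := exists_between (energy_exp_lt H.two_lt ha0 ha₁a)
  -- chosen so that the decay rate `(1 - ε) (m + p) / a₁ - m / b` is half of `(m + p) / a₁ - m / b`
  set ε := (1 - a₁ * m / (b * (m + p))) / 2 with hεdef
  have hε1 : a₁ * m < b * (m + p) := by rwa [lt_div_iff₀ hm] at ha₁
  have hε2 : a₁ * m / (b * (m + p)) < 1 := (div_lt_one (by positivity)).2 hε1
  have hε3 : 0 < a₁ * m / (b * (m + p)) := by positivity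
  have hε : 0 < ε := by linarith
  obtain ⟨T₀, hT₀⟩ := ((H.eventually_frontEnergy_sub hε).and
    ((H.tendsto_front.eventually_gt_atTop 1).and
    ((H.eventually_energy ha₁0 (sub_one_lt _) hd1).and
      ((H.eventually_energy ha0 hd2 (lt_add_one _)).and
        (eventually_ge_atTop 0))))).exists_forall_of_atTop
  have hrate : (1 - ε) * ((m + p) / a₁) = (m / b + (m + p) / a₁) / 2 := by
    rw [hεdef]
    field_simp
    ring
  have hrate' : 0 < ((m + p) / a₁ - m / b) / 2 := by
    have : m / b < (m + p) / a₁ := by rw [div_lt_div_iff₀ hb ha₁0]; linarith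
    linarith
  have key := eventually_lt_of_barrier (Q := fun T => -frontScale f b m p κ T)
    (G := fun T => -frontEnergy f b m p κ T) (T₀ := T₀) (neg_lt_neg ha₁a) hrate'
    (H.continuousOn_frontScale (hT₀ T₀ le_rfl).2.1).neg H.tendsto_cumulative H.cumulative_mono
    (fun T₁ T₂ h1 h2 hq => ?_)
    (fun t ht hq => neg_le_neg ((hT₀ t ht).2.2.1.2 (neg_le_neg_iff.1 hq)).le)
    (fun T₁ T₂ h1 h2 hq1 hq2 => neg_lt_neg
      (((hT₀ T₁ h1).2.2.1.1 (neg_inj.1 hq1).ge).trans ((hT₀ T₂ h2).2.2.2.1.2 (neg_inj.1 hq2).le)))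
  · exact key.mono fun T hT => neg_lt_neg_iff.1 hT
  have h3 := abs_le.1 ((hT₀ T₀ le_rfl).1 T₁ T₂ h1 h2)
  have h4 := H.le_potential_front_sub ((hT₀ T₁ h1).2.2.2.2) (hT₀ T₁ h1).2.1 h2
    fun t ht => neg_le_neg_iff.1 (hq t ht)
  have h5 := mul_le_mul_of_nonneg_left h4 (by linarith : 0 ≤ 1 - ε)
  rw [← mul_assoc, hrate] at h5
  linarith [h3.2]

theorem tendsto_frontScale (H : IsCriticalFlow f w b m p κ) :
    Tendsto (frontScale f b m p κ) atTop (𝓝 (b * (m + p) / m)) := by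
  have hA : 0 < b * (m + p) / m :=
    div_pos (mul_pos H.b_pos (by linarith [H.m_pos, H.p_nonneg])) H.m_pos
  refine tendsto_order.2 ⟨fun a ha => ?_, fun a ha => H.eventually_frontScale_lt ha⟩
  exact (H.eventually_lt_frontScale (lt_max_of_lt_right (half_pos hA))
    (max_lt ha (half_lt_self hA))).mono fun T hT => (le_max_left _ _).trans_lt hT

/-! ### Convergence of the beta function -/

/-- The logarithmic derivative of `w(·,T)` is that of the exponential of `-potential f`, up to a
factor close to `1`. -/
theorem density_bounds (H : IsCriticalFlow f w b m p κ) {T u v η V : ℝ} (hT : 0 ≤ T)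
    (hV : 1 < V) (hVT : V ≤ front b m p κ T)
    (hS : ∀ v v', V ≤ v → v ≤ v' →
      |(Real.log (profile f v) - Real.log (profile f v')) - (potential f v' - potential f v)| ≤
        η * (potential f v' - potential f v))
    (hu : 1 ≤ u) (hx : 1 - 1 / u ∈ betaDomain (fun x => w x T))
    (hv : v = dilation b m κ T * u + shift b m p κ T) :
    |density (fun x => w x T) (1 - 1 / u) / w (1 - 1 / u) T -
        dilation b m κ T * u ^ 2 / scale f v| ≤ η * (dilation b m κ T * u ^ 2 / scale f v) := by
  obtain ⟨hxI, hdiff⟩ := hx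
  have hu0 : 0 < u := by linarith
  have hdil := dilation_pos (b := b) (m := m) (κ := κ) T
  set α := dilation b m κ T
  set γ := shift b m p κ T
  have harg : ∀ z ∈ Ico (0 : ℝ) 1, V ≤ α * (1 / (1 - z)) + γ := fun z hz => by
    have h1 : 0 < 1 - z := by linarith [hz.2]
    have h2 : α * 1 ≤ α * (1 / (1 - z)) :=
      mul_le_mul_of_nonneg_left ((one_le_div h1).2 (by linarith [hz.1])) hdil.le
    have h3 : front b m p κ T = α + γ := rfl
    linarith
  have hmono : ∀ y ∈ Ico (0 : ℝ) 1, ∀ z ∈ Ico (0 : ℝ) 1, y ≤ z →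
      α * (1 / (1 - y)) + γ ≤ α * (1 / (1 - z)) + γ := fun y _ z hz hyz => by
    have h1 : 0 < 1 - z := by linarith [hz.2]
    have := one_div_le_one_div_of_le h1 (by linarith : 1 - z ≤ 1 - y)
    gcongr
  have hlog : ∀ z ∈ Ico (0 : ℝ) 1,
      Real.log (w z T) = T + Real.log (profile f (α * (1 / (1 - z)) + γ)) := fun z hz => by
    rw [H.eq_exp' hT hz, Real.log_mul (Real.exp_pos T).ne'
      (H.datum.profile_pos (hV.le.trans (harg z hz))).ne', Real.log_exp]
  have hwpos : 0 < w (1 - 1 / u) T := by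
    rw [H.eq_exp T hT u hu]
    exact mul_pos (Real.exp_pos T) (H.datum.profile_pos (H.one_le_arg hT hu))
  have hvu : α * (1 / (1 - (1 - 1 / u))) + γ = v := by
    rw [sub_sub_cancel, one_div_one_div, hv]
  have hv1 : 1 < v := hvu ▸ hV.trans_le (harg _ hxI)
  have hdw : HasDerivWithinAt (fun z => Real.log (w z T))
      (-density (fun x => w x T) (1 - 1 / u) / w (1 - 1 / u) T) (Ico 0 1) (1 - 1 / u) := by
    rw [density, neg_neg]
    exact hdiff.hasDerivWithinAt.log hwpos.ne'
  have hdp : HasDerivWithinAt (fun z => potential f (α * (1 / (1 - z)) + γ))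
      (α * u ^ 2 / scale f v) (Ico 0 1) (1 - 1 / u) := by
    have h1 : HasDerivAt (fun z : ℝ => α * (1 / (1 - z)) + γ) (α * u ^ 2) (1 - 1 / u) := by
      have h2 : 1 - (1 - 1 / u) ≠ 0 := by rw [sub_sub_cancel]; positivity
      have := (((((hasDerivAt_id (1 - 1 / u)).const_sub 1).inv h2).const_mul α).add_const γ)
      simp only [one_div] at this ⊢
      refine this.congr_deriv ?_
      simp
    have h3 := H.datum.potential_hasDerivAt hv1
    rw [← hvu] at h3
    refine ((h3.comp (1 - 1 / u) h1).congr_deriv ?_).hasDerivWithinAt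
    rw [hvu]
    ring
  have huniq := uniqueDiffOn_Ico (0 : ℝ) 1 _ hxI
  have m1 : MonotoneOn (fun z => (1 + η) * potential f (α * (1 / (1 - z)) + γ) +
      Real.log (w z T)) (Ico 0 1) := by
    intro y hy z hz hyz
    have := (abs_le.1 (hS _ _ (harg y hy) (hmono y hy z hz hyz))).2
    simp only [hlog y hy, hlog z hz]
    linarith
  have m2 : AntitoneOn (fun z => (1 - η) * potential f (α * (1 / (1 - z)) + γ) +
      Real.log (w z T)) (Ico 0 1) := by
    intro y hy z hz hyz
    have := (abs_le.1 (hS _ _ (harg y hy) (hmono y hy z hz hyz))).1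
    simp only [hlog y hy, hlog z hz]
    linarith
  have d1 := m1.derivWithin_nonneg (x := 1 - 1 / u)
  have d2 := m2.derivWithin_nonpos (x := 1 - 1 / u)
  rw [((hdp.const_mul (1 + η)).fun_add hdw).derivWithin huniq, neg_div] at d1
  rw [((hdp.const_mul (1 - η)).fun_add hdw).derivWithin huniq, neg_div] at d2
  rw [abs_le]
  constructor <;> linarith

theorem eventually_abs_beta_sub_le (H : IsCriticalFlow f w b m p κ) {ε : ℝ} (hε : 0 < ε) :
    ∀ᶠ T in atTop, ∀ u, 1 ≤ u → 1 - 1 / u ∈ betaDomain (fun x => w x T) →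
      |beta (fun x => w x T) (1 - 1 / u) -
        weighted (fun s => Real.exp (-s)) (b * (m + p) / m / u)| ≤ ε := by
  have hη : 0 < min (ε / 7) 1 := lt_min (by linarith) one_pos
  set η := min (ε / 7) 1
  have hη7 : 7 * η ≤ ε := by have := min_le_left (ε / 7) 1; simp only [η]; linarith
  have hη1 : η ≤ 1 := min_le_right _ _
  set A := b * (m + p) / m
  have hA : 0 < A := div_pos (mul_pos H.b_pos (by linarith [H.m_pos, H.p_nonneg])) H.m_pos
  obtain ⟨V, hV⟩ := ((H.datum.eventually_slowly_varying H.critical hη).and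
    ((H.datum.eventually_integrableOn_rescaled H.critical).and
      ((H.datum.tendsto_integral_abs_rescaled_sub_exp H.critical).eventually
        (gt_mem_nhds hη)))).exists_forall_of_atTop
  have hq := H.tendsto_frontScale.eventually (Metric.ball_mem_nhds A hη)
  filter_upwards [H.tendsto_front.eventually_ge_atTop V, hq, eventually_ge_atTop 0]
    with T hVT hqT hT u hu hx
  have hu0 : 0 < u := by linarith
  have hdil := dilation_pos (b := b) (m := m) (κ := κ) T
  obtain ⟨v, hv⟩ : ∃ v, v = dilation b m κ T * u + shift b m p κ T := ⟨_, rfl⟩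
  have hfv : front b m p κ T ≤ v := by
    have := mul_le_mul_of_nonneg_left hu hdil.le
    rw [hv, front]
    linarith
  obtain ⟨⟨hv1, -⟩, ⟨-, hint⟩, hL1⟩ := hV v (hVT.trans hfv)
  have hρ := H.datum.scale_pos hv1.le
  have hdens := H.density_bounds hT (hV V le_rfl).1.1 hVT
    (fun y z hy hyz => ((hV V le_rfl).1.2 y z hy hyz).1) hu hx hv
  have hlip := ((hV V le_rfl).1.2 _ v hVT hfv).2.2
  have htail := H.tail_eq hT hu hv
  have hW := H.datum.profile_pos hv1.le
  have hwx : w (1 - 1 / u) T = Real.exp T * profile f v := by rw [H.eq_exp T hT u hu, hv]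
  have hwpos : 0 < w (1 - 1 / u) T := by rw [hwx]; positivity
  obtain ⟨r, hr⟩ : ∃ r, r = scale f v / dilation b m κ T / u := ⟨_, rfl⟩
  have hr0 : 0 < r := by rw [hr]; positivity
  set B := weighted (rescaled f v) r with hB
  have hB0 : 0 < B := weighted_pos hint (fun s hs => H.datum.rescaled_pos hv1.le hs.le) hr0.le
  -- `β = (1 + O(η)) B`
  have hβ : |beta (fun x => w x T) (1 - 1 / u) - B| ≤ η * B := by
    rw [← hwx, ← hr, ← hB] at htail
    have e1 : beta (fun x => w x T) (1 - 1 / u) - B =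
        (density (fun x => w x T) (1 - 1 / u) / w (1 - 1 / u) T -
          dilation b m κ T * u ^ 2 / scale f v) *
            (scale f v / (dilation b m κ T * u ^ 2) * B) := by
      rw [beta, htail]
      field_simp
    have e2 : η * B = η * (dilation b m κ T * u ^ 2 / scale f v) *
        (scale f v / (dilation b m κ T * u ^ 2) * B) := by
      field_simp
    have e3 : 0 < scale f v / (dilation b m κ T * u ^ 2) * B := by positivity
    rw [e1, e2, abs_mul, abs_of_pos e3]
    exact mul_le_mul_of_nonneg_right hdens e3.le
  have hBexp := abs_le.1 ((abs_weighted_sub_le hint integrableOn_exp_neg hr0.le).trans hL1.le)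
  rw [← hB] at hBexp
  have hone := weighted_exp_le_one hr0.le
  -- the length scale at `v` in units of `dilation * u` is close to `A / u`
  have hrA : |r - A / u| ≤ 2 * η := by
    have e1 : r - A / u = (scale f v - scale f (front b m p κ T)) / (dilation b m κ T * u) +
        (frontScale f b m p κ T - A) / u := by
      rw [hr, frontScale]
      field_simp
      ring
    have e2 : |(scale f v - scale f (front b m p κ T)) / (dilation b m κ T * u)| ≤ η := by
      rw [abs_div, abs_of_pos (by positivity : 0 < dilation b m κ T * u),
        div_le_iff₀ (by positivity)]
      refine hlip.trans (mul_le_mul_of_nonneg_left ?_ hη.le)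
      rw [hv, front]
      linarith
    have e3 : |(frontScale f b m p κ T - A) / u| ≤ η := by
      rw [abs_div, abs_of_pos hu0, div_le_iff₀ hu0]
      have h1 : |frontScale f b m p κ T - A| < η := hqT
      have h2 := mul_le_mul_of_nonneg_left hu hη.le
      linarith
    rw [e1]
    exact (abs_add_le _ _).trans (by linarith)
  have hexp := abs_le.1 (abs_weighted_exp_sub_le hr0.le (div_pos hA hu0).le)
  have hβ' := abs_le.1 hβ
  have hηB : η * B ≤ 2 * η := by
    have : B ≤ 2 := by linarith [hBexp.2]
    have := mul_le_mul_of_nonneg_left this hη.le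
    linarith
  rw [abs_le]
  constructor <;> linarith [hexp.1, hexp.2, hβ'.1, hβ'.2, hBexp.1, hBexp.2]

end IsCriticalFlow

/-- A solution with critical data is a critical flow, after replacing `κ` by its continuous
extension `κ (max s 0)` to `ℝ`. -/
theorem IsSolution.isCriticalFlow {φ ψ κ : ℝ → ℝ} {w : ℝ → ℝ → ℝ} {b m p : ℝ}
    (hw : IsSolution φ ψ w κ) (hb : 0 < b) (hb1 : b < 1) (hm : 0 < m) (hp : 0 ≤ p)
    (hφ : ∀ x, φ x = b * x * (1 - x)) (hψ : ∀ x, ψ x = (1 - x) * (m + p * (1 - x)))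
    (hw₀ : IsInitialDatum (fun x => w x 0))
    (hcrit : Tendsto (beta (fun x => w x 0)) (𝓝[betaDomain (fun x => w x 0)] 1) (𝓝 1)) :
    IsCriticalFlow (fun x => w x 0) w b m p (fun s => κ (max s 0)) := by
  have hcont : Continuous fun s => κ (max s 0) :=
    hw.continuous_κ.comp_continuous (by fun_prop) fun s => le_max_right s 0
  have hw' := hw.congr (κ' := fun s => κ (max s 0)) fun s hs => by rw [max_eq_left hs]
  exact
    { b_pos := hb
      b_lt_one := hb1
      m_pos := hm
      p_nonneg := hp
      continuous_κ := hcont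
      κ_nonneg := fun s => hw.kappa_nonneg (by rw [hφ]; ring)
        (by rw [hψ]; linarith) (le_max_right s 0)
      datum := hw₀
      critical := hcrit
      eq_exp := fun T hT u hu => hw'.eq_exp_mul_profile hcont hφ hψ hT hu
      mass := hw.mass }

end LSW

theorem proposition5p1 (φ ψ : ℝ → ℝ) (hm : LSW.IsQuadraticModel φ ψ)
    (w : ℝ → ℝ → ℝ) (κ : ℝ → ℝ) (hw : LSW.IsSolution φ ψ w κ)
    (hw₀ : LSW.IsInitialDatum (fun x => w x 0))
    -- critical initial data: `β(x,0) → 1` as `x → 1`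
    (hcrit : Tendsto (LSW.beta (fun x => w x 0)) (𝓝[LSW.betaDomain (fun x => w x 0)] 1) (𝓝 1))
    -- `β(x,0) ≤ 1` near `x = 1`
    (hle : ∃ δ > (0 : ℝ), ∀ x ∈ LSW.betaDomain (fun x => w x 0), 1 - δ ≤ x →
      LSW.beta (fun x => w x 0) x ≤ 1) :
    ∀ ε > (0 : ℝ), ∃ T : ℝ, ∀ t ≥ T, ∀ x ∈ LSW.betaDomain (fun z => w z t),
      |LSW.beta (fun z => w z t) x -
        LSW.beta (LSW.stationary φ ψ (LSW.kappaZero φ ψ)) x| ≤ ε := by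
  intro ε hε
  obtain ⟨b, m, p, hb, hb1, hm0, hp, hφ, hψ, hκ⟩ := hm.exists_coefficients
  have H := hw.isCriticalFlow hb hb1 hm0 hp hφ hψ hw₀ hcrit
  have hA : 0 < b * (m + p) / m := by positivity
  have hquad : ∀ x, LSW.kappaZero φ ψ * ψ x - φ x = b * (m + p) / m * (1 - x) ^ 2 := by
    intro x
    rw [hκ, hφ, hψ]
    field_simp
    ring
  obtain ⟨T, hT⟩ := (H.eventually_abs_beta_sub_le hε).exists_forall_of_atTop
  refine ⟨T, fun t ht x hx => ?_⟩
  have hx1 : 0 < 1 - x := by linarith [hx.1.2]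
  have hu : 1 ≤ 1 / (1 - x) := (one_le_div hx1).2 (by linarith [hx.1.1])
  have hxu : x = 1 - 1 / (1 / (1 - x)) := by rw [one_div_one_div, sub_sub_cancel]
  have h := hT t ht (1 / (1 - x)) hu (hxu ▸ hx)
  rwa [← LSW.beta_stationary hm hA hquad hu, ← hxu] at h
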